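/- **Area of the Kochawave curve.** Identify the plane with $\mathbb{C}$ and let $\omega=e^{i\pi/3}$. *Construction with segments.* Start from the unit segment $0\to 1$; one iteration replaces each directed segment $A\to E$ of the current polygonal curve by the four segments $A\to B\to C\to D\to E$, where $B=A+\frac{E-A}{3}$, $D=A+\frac{2(E-A)}{3}$ and $C=D+\omega(E-D)$ (so $A,B,D,E$ are collinear and equally spaced, and $DEC$ is a counterclockwise equilateral triangle). Let $K_n$ be the set of endpoints of the segments after $n$ iterations; the Kochawave curve is $K=\overline{\bigcup_n K_n}$. Let $A_n$ be the area enclosed between the polygonal curve after $n$ iterations and the initial segment, i.e. the Lebesgue measure of the set of points off the closed polygonal curve, formed by the polygonal curve from $0$ to $1$ and the segment from $1$ back to $0$, around which this closed curve has nonzero winding number. *Construction with triangles.* Start from the unit equilateral triangle $\Delta$ with vertices $0,1,\omega$; one iteration replaces each equilateral triangle $PQR$ (vertices in counterclockwise order, side $w$) by the three triangles of side $w/3$ at its corners and the equilateral triangle of side $w/\sqrt3$ with vertices $P+\frac{Q-P}{3}$, $Q+\frac{R-Q}{3}$, $R+\frac{P-R}{3}$. Let $T_n$ be the area of the union of the triangles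 after $n$ iterations. Then, for every $n\ge 0$, $$3A_n+T_n=\frac{\sqrt3}{4},\qquad A_n=\frac{1}{4\sqrt3}\left[1-\left(\frac23\right)^n\right],\qquad\text{and}\qquad \lim_{n\to\infty}A_n=\frac{1}{4\sqrt3}.$$ Moreover, let $W$ be the plane region of the Kochawave curve, i.e. the union of $K$, the base segment $[0,1]$ and all bounded connected components of the complement of $K\cup[0,1]$. Then $W$ has area $A=\frac{1}{4\sqrt3}$, which is one third of the area of $\Delta$. For $a\neq b$ in $\mathbb{C}$ let $W_{a,b}=\{a+(b-a)z: z\in W\}$ be the copy of $W$ on the base segment $a\to b$. Then $$\Delta=W_{0,1}\cup W_{1,\omega}\cup W_{\omega,0},$$ and any two of these three copies of $W$ intersect in a set of area $0$. -/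

import Mathlib

open MeasureTheory Filter Topology

namespace Kochawave

noncomputable section

/-- The primitive sixth root of unity `exp (iπ/3)`: multiplication by it is the counterclockwise
rotation by 60 degrees. -/
def omega : ℂ := Complex.exp (Real.pi / 3 * Complex.I)

/-! ### The polygonal curves and the Kochawave curve -/

/-- The replacement rule for one directed segment `A → E` (a pair of endpoints): it becomes
`A → B → C → D → E`, where `A, B, D, E` are collinear and equally spaced in that order and `C` is
such that `D E C` is a counterclockwise oriented equilateral triangle. -/
def replaceSegment (s : ℂ × ℂ) : List (ℂ × ℂ) :=
  let A := s.1
  let E := s.2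
  let B := A + (E - A) / 3
  let D := A + 2 * (E - A) / 3
  let C := D + omega * (E - D)
  [(A, B), (B, C), (C, D), (D, E)]

/-- The directed segments, in order, of the polygonal curve after `n` iterations, starting from
the unit segment `0 → 1`. -/
def segments : ℕ → List (ℂ × ℂ)
  | 0 => [(0, 1)]
  | n + 1 => (segments n).flatMap replaceSegment

/-- The set of endpoints of the segments after `n` iterations. -/
def endpoints (n : ℕ) : Set ℂ := {z | ∃ s ∈ segments n, z = s.1 ∨ z = s.2}

/-- The Kochawave curve: the closure of the limit of the increasing sequence of the sets of
endpoints. -/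
def curve : Set ℂ := closure (⋃ n, endpoints n)

/-! ### The region between the polygonal curve and the initial segment -/

/-- The union of a list of segments. -/
def trace (l : List (ℂ × ℂ)) : Set ℂ := ⋃ s ∈ l, segment ℝ s.1 s.2

/-- The winding number of a closed polygonal curve, given by its consecutive directed edges,
around a point `p` that does not lie on it: the sum of the oriented angles, in `(-π, π)`, under
which the edges are seen from `p`, divided by `2π`. -/
def windingNumber (l : List (ℂ × ℂ)) (p : ℂ) : ℝ :=
  (l.map fun s => Complex.arg ((s.2 - p) / (s.1 - p))).sum / (2 * Real.pi)

/-- The closed polygonal curve that runs through the curve after `n` iterations from `0` to `1`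
and then back along the initial segment from `1` to `0`. -/
def closedPolygon (n : ℕ) : List (ℂ × ℂ) := segments n ++ [(1, 0)]

/-- The region enclosed between the polygonal curve after `n` iterations and the initial segment:
the points off the closed polygonal curve around which it winds. -/
def enclosedRegion (n : ℕ) : Set ℂ :=
  {p | p ∉ trace (closedPolygon n) ∧ windingNumber (closedPolygon n) p ≠ 0}

/-- The area `A_n` enclosed between the polygonal curve after `n` iterations and the initial
segment. -/
def areaBetween (n : ℕ) : ℝ := volume.real (enclosedRegion n)

/-! ### The construction with triangles -/

/-- The replacement rule for one equilateral triangle with counterclockwise vertices `P, Q, R`: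
it becomes the three triangles of one third of its side length at its corners, and the equilateral
triangle whose vertices are the points at one third of the sides `P → Q`, `Q → R` and `R → P`. -/
def replaceTriangle (t : ℂ × ℂ × ℂ) : List (ℂ × ℂ × ℂ) :=
  let P := t.1
  let Q := t.2.1
  let R := t.2.2
  [(P, P + (Q - P) / 3, P + (R - P) / 3),
   (Q + (P - Q) / 3, Q, Q + (R - Q) / 3),
   (R + (P - R) / 3, R + (Q - R) / 3, R),
   (P + (Q - P) / 3, Q + (R - Q) / 3, R + (P - R) / 3)]

/-- The triangles after `n` iterations, starting from the unit sided equilateral triangle with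
vertices `0, 1, omega`. -/
def triangles : ℕ → List (ℂ × ℂ × ℂ)
  | 0 => [(0, 1, omega)]
  | n + 1 => (triangles n).flatMap replaceTriangle

/-- The closed solid triangle with given vertices. -/
def solidTriangle (t : ℂ × ℂ × ℂ) : Set ℂ := convexHull ℝ {t.1, t.2.1, t.2.2}

/-- The area `T_n` of the structure after `n` iterations of the construction with triangles. -/
def triangleArea (n : ℕ) : ℝ := volume.real (⋃ t ∈ triangles n, solidTriangle t)

/-- The unit sided equilateral triangle. -/
def unitTriangle : Set ℂ := solidTriangle (0, 1, omega)

/-! ### The region of the Kochawave curve -/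

/-- A set together with everything that it encloses, that is, with the bounded connected
components of its complement. -/
def fill (S : Set ℂ) : Set ℂ :=
  S ∪ {z | z ∉ S ∧ Bornology.IsBounded (connectedComponentIn Sᶜ z)}

/-- The Kochawave curve as a plane figure: the Kochawave curve and its base segment, together with
what they enclose. -/
def waveRegion : Set ℂ := fill (curve ∪ segment ℝ 0 1)

/-- The copy of the plane figure of the Kochawave curve on the directed base segment `a → b`: its
image under the orientation preserving similarity that takes `0` to `a` and `1` to `b`. -/
def waveRegionOn (a b : ℂ) : Set ℂ := (fun z => a + (b - a) * z) '' waveRegion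

end

end Kochawave

namespace Kochawave

/-! ### Coordinates -/

/-! Each iteration raises a copy of `core` over every segment. Let `filledAt n` be the union of the
triangles raised in the first n iterations, and `filled` the closure of their union over all n. The
areas come from a squeeze that never checks that triangles do not overlap. The squared lengths of
the four replacing segments add up to 3·(1/9) + 1/3 = 2/3 of the old one, so subadditivity bounds
the area of `filledAt n` by √3/12·(1 - (2/3)^n), and likewise T_n by √3/4·(2/3)^n. Conversely, an
equilateral tile is covered by its four replacements and the cores over its three sides, and the
sides of the replacements are exactly the twelve segments that replace its sides. Hence three
rotated copies of `filledAt n`, with the tiles of level n, cover the unit triangle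
(`unitTriangle_subset`). Its area √3/4 is the total of the upper bounds, so all of them are
equalities. In the limit three copies of `filled` cover the triangle, have area √3/12 each, and meet
in null sets.

For A_n, a replacement changes the angle seen from a generic point by -2π if the point lies in the
raised triangle and by 0 otherwise (`Generic.angle_step`). All contributions have the same sign, so
the winding number is nonzero exactly on `filledAt n`, up to a null set.

It remains to see that `waveRegion` is `filled`. Right of a segment lies the triangle it was raised
with, or the half plane below the base; left of it, away from the curve, lies a raised triangle. So
`filled` is open off the curve and the base (`mem_interior_filled`), and a component of the
complement that meets `filled` stays in it. Conversely, a point of the unit triangle off `filled`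
lies in another copy. After a rotation it is a point of `filled` that has to be led to infinity
avoiding a further copy X. The overlap being null, X misses the interior of `filled ∪ lowerHalf`, so
one can descend from triangle to triangle through their bases and leave through [0, 1]
(`escapes_segment`). -/

theorem sqrt3_mul_self : √3 * √3 = (3 : ℝ) := Real.mul_self_sqrt (by norm_num)

theorem omega_re : omega.re = 1 / 2 := by
  have : (Real.pi / 3 * Complex.I : ℂ) = ((Real.pi / 3 : ℝ) : ℂ) * Complex.I := by push_cast; ring
  rw [omega, this, Complex.exp_ofReal_mul_I_re, Real.cos_pi_div_three]

theorem omega_im : omega.im = √3 / 2 := by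
  have : (Real.pi / 3 * Complex.I : ℂ) = ((Real.pi / 3 : ℝ) : ℂ) * Complex.I := by push_cast; ring
  rw [omega, this, Complex.exp_ofReal_mul_I_im, Real.sin_pi_div_three]

theorem omega_mul_omega : omega * omega = omega - 1 := by
  have h := sqrt3_mul_self
  apply Complex.ext
  · simp only [Complex.mul_re, Complex.sub_re, omega_re, omega_im, Complex.one_re]; linarith
  · simp only [Complex.mul_im, Complex.sub_im, omega_re, omega_im, Complex.one_im]; linarith

/-- The imaginary part, scaled by `√3` so that the vertices of the triangular lattice have rational
coordinates. -/
noncomputable def ht (z : ℂ) : ℝ := √3 * z.im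

theorem ht_add (z w : ℂ) : ht (z + w) = ht z + ht w := by simp [ht, mul_add]
theorem ht_sub (z w : ℂ) : ht (z - w) = ht z - ht w := by simp [ht, mul_sub]
theorem ht_neg (z : ℂ) : ht (-z) = -ht z := by simp [ht]
theorem ht_ofReal (x : ℝ) : ht (x : ℂ) = 0 := by simp [ht]
theorem ht_zero : ht 0 = 0 := by simp [ht]
theorem ht_one : ht 1 = 0 := by simp [ht]
theorem ht_ofReal_mul (x : ℝ) (z : ℂ) : ht (x * z) = x * ht z := by
  simp only [ht, Complex.im_ofReal_mul]; ring
theorem ht_omega_mul (z : ℂ) : ht (omega * z) = ht z / 2 + 3 * z.re / 2 := by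
  simp only [ht, Complex.mul_im, omega_re, omega_im]
  linear_combination z.re / 2 * sqrt3_mul_self
theorem re_omega_mul (z : ℂ) : (omega * z).re = z.re / 2 - ht z / 2 := by
  simp only [ht, Complex.mul_re, omega_re, omega_im]; ring
theorem ht_omega : ht omega = 3 / 2 := by simpa using ht_omega_mul 1 |>.trans (by simp [ht])

theorem ext_ht {z w : ℂ} (h₁ : z.re = w.re) (h₂ : ht z = ht w) : z = w := by
  refine Complex.ext h₁ (mul_left_cancel₀ (a := √3) (by positivity) h₂)

theorem ht_nonneg_iff {z : ℂ} : 0 ≤ ht z ↔ 0 ≤ z.im := by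
  simp [ht]

theorem continuous_ht : Continuous ht := by unfold ht; fun_prop

theorem abs_ht_le (z : ℂ) : |ht z| ≤ 2 * ‖z‖ := by
  rw [ht, abs_mul, abs_of_nonneg (Real.sqrt_nonneg 3)]
  have h1 : √3 ≤ 2 := by rw [Real.sqrt_le_left (by norm_num)]; norm_num
  exact mul_le_mul h1 (Complex.abs_im_le_norm z) (abs_nonneg _) (by norm_num)

theorem normSq_eq_ht (z : ℂ) : Complex.normSq z = z.re ^ 2 + ht z ^ 2 / 3 := by
  rw [Complex.normSq_apply, ht]; linear_combination -(z.im ^ 2) / 3 * sqrt3_mul_self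

/-! ### Similarities -/

/-- The orientation preserving similarity which takes `0 → 1` to a given directed segment. -/
noncomputable def sim (s : ℂ × ℂ) (z : ℂ) : ℂ := s.1 + (s.2 - s.1) * z

/-- The image of a directed segment under `sim s`. -/
noncomputable def simPair (s e : ℂ × ℂ) : ℂ × ℂ := (sim s e.1, sim s e.2)

@[simp] theorem sim_zero (s : ℂ × ℂ) : sim s 0 = s.1 := by simp [sim]
@[simp] theorem sim_one (s : ℂ × ℂ) : sim s 1 = s.2 := by simp [sim]
theorem sim_unit (z : ℂ) : sim (0, 1) z = z := by simp [sim]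

theorem sim_simPair (s e : ℂ × ℂ) (z : ℂ) : sim (simPair s e) z = sim s (sim e z) := by
  simp only [sim, simPair]; ring

theorem simPair_simPair (s e d : ℂ × ℂ) : simPair (simPair s e) d = simPair s (simPair e d) := by
  simp only [simPair, ← sim_simPair]

@[simp] theorem simPair_unit (s : ℂ × ℂ) : simPair s (0, 1) = s := by simp [simPair]

theorem simPair_sub (s e : ℂ × ℂ) :
    (simPair s e).2 - (simPair s e).1 = (s.2 - s.1) * (e.2 - e.1) := by
  simp only [simPair, sim]; ring

theorem sim_sub (s : ℂ × ℂ) (z w : ℂ) : sim s z - sim s w = (s.2 - s.1) * (z - w) := by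
  simp only [sim]; ring

theorem dist_sim (s : ℂ × ℂ) (z w : ℂ) : dist (sim s z) (sim s w) = ‖s.2 - s.1‖ * dist z w := by
  rw [dist_eq_norm, sim_sub, norm_mul, dist_eq_norm]

theorem continuous_sim (s : ℂ × ℂ) : Continuous (sim s) := by unfold sim; fun_prop

/-- The inverse of `sim s`. -/
noncomputable def simInv (s : ℂ × ℂ) (z : ℂ) : ℂ := (z - s.1) / (s.2 - s.1)

theorem continuous_simInv (s : ℂ × ℂ) : Continuous (simInv s) := by unfold simInv; fun_prop

theorem sim_simInv {s : ℂ × ℂ} (h : s.1 ≠ s.2) (z : ℂ) : sim s (simInv s z) = z := by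
  have : s.2 - s.1 ≠ 0 := sub_ne_zero.2 h.symm
  simp only [sim, simInv]; field_simp; ring

theorem simInv_sim {s : ℂ × ℂ} (h : s.1 ≠ s.2) (z : ℂ) : simInv s (sim s z) = z := by
  have : s.2 - s.1 ≠ 0 := sub_ne_zero.2 h.symm
  simp only [sim, simInv]; field_simp; ring

/-- `sim s` as a homeomorphism. -/
noncomputable def simHomeomorph {s : ℂ × ℂ} (h : s.1 ≠ s.2) : ℂ ≃ₜ ℂ where
  toFun := sim s
  invFun := simInv s
  left_inv := simInv_sim h
  right_inv := sim_simInv h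
  continuous_toFun := continuous_sim s
  continuous_invFun := continuous_simInv s

@[simp] theorem coe_simHomeomorph {s : ℂ × ℂ} (h : s.1 ≠ s.2) : ⇑(simHomeomorph h) = sim s := rfl

theorem image_sim {s : ℂ × ℂ} (h : s.1 ≠ s.2) (X : Set ℂ) : sim s '' X = simInv s ⁻¹' X :=
  congrFun (Set.image_eq_preimage_of_inverse (simInv_sim h) (sim_simInv h)) X

theorem sim_combination (s : ℂ × ℂ) {a b c : ℝ} (h : a + b + c = 1) (P Q R : ℂ) :
    sim s (a * P + b * Q + c * R) = a * sim s P + b * sim s Q + c * sim s R := by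
  have h' : (a : ℂ) + b + c = 1 := by exact_mod_cast h
  simp only [sim]; linear_combination -s.1 * h'

/-! ### Solid triangles -/

theorem mem_solidTriangle {P Q R z : ℂ} : z ∈ solidTriangle (P, Q, R) ↔
    ∃ a b c : ℝ, 0 ≤ a ∧ 0 ≤ b ∧ 0 ≤ c ∧ a + b + c = 1 ∧ z = a * P + b * Q + c * R := by
  constructor
  · intro h
    refine convexHull_min (t := {z : ℂ | ∃ a b c : ℝ, 0 ≤ a ∧ 0 ≤ b ∧ 0 ≤ c ∧ a + b + c = 1 ∧
      z = a * P + b * Q + c * R}) ?_ ?_ h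
    · rintro w (rfl | rfl | rfl)
      · exact ⟨1, 0, 0, by norm_num, le_rfl, le_rfl, by norm_num, by simp⟩
      · exact ⟨0, 1, 0, le_rfl, by norm_num, le_rfl, by norm_num, by simp⟩
      · exact ⟨0, 0, 1, le_rfl, le_rfl, by norm_num, by norm_num, by simp⟩
    · rintro _ ⟨a, b, c, ha, hb, hc, h, rfl⟩ _ ⟨a', b', c', ha', hb', hc', h', rfl⟩ u v hu hv huv
      refine ⟨u * a + v * a', u * b + v * b', u * c + v * c', by positivity, by positivity,
        by positivity, by linear_combination u * h + v * h' + huv, ?_⟩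
      simp only [Complex.real_smul]; push_cast; ring
  · rintro ⟨a, b, c, ha, hb, hc, h, rfl⟩
    have hP : P ∈ solidTriangle (P, Q, R) := subset_convexHull ℝ _ (by simp)
    have hQ : Q ∈ solidTriangle (P, Q, R) := subset_convexHull ℝ _ (by simp)
    have hR : R ∈ solidTriangle (P, Q, R) := subset_convexHull ℝ _ (by simp)
    have hK : Convex ℝ (solidTriangle (P, Q, R)) := convex_convexHull ℝ _
    have := hK.sum_mem (t := Finset.univ) (w := ![a, b, c]) (z := ![P, Q, R])
      (by intro i _; fin_cases i <;> assumption) (by simpa [Fin.sum_univ_three] using h)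
      (by intro i _; fin_cases i <;> assumption)
    simpa [Fin.sum_univ_three] using this

theorem sim_image_solidTriangle (s : ℂ × ℂ) (P Q R : ℂ) :
    sim s '' solidTriangle (P, Q, R) = solidTriangle (sim s P, sim s Q, sim s R) := by
  ext z
  simp only [Set.mem_image, mem_solidTriangle]
  constructor
  · rintro ⟨_, ⟨a, b, c, ha, hb, hc, h, rfl⟩, rfl⟩
    exact ⟨a, b, c, ha, hb, hc, h, sim_combination s h P Q R⟩
  · rintro ⟨a, b, c, ha, hb, hc, h, rfl⟩
    exact ⟨_, ⟨a, b, c, ha, hb, hc, h, rfl⟩, sim_combination s h P Q R⟩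

theorem mem_unitTriangle {z : ℂ} :
    z ∈ unitTriangle ↔ 0 ≤ ht z ∧ ht z ≤ 3 * z.re ∧ ht z ≤ 3 - 3 * z.re := by
  rw [unitTriangle, mem_solidTriangle]
  constructor
  · rintro ⟨a, b, c, ha, hb, hc, h, rfl⟩
    simp only [ht_add, ht_ofReal_mul, ht_omega, ht_zero, ht_one, Complex.add_re,
      Complex.re_ofReal_mul, omega_re, Complex.zero_re, Complex.one_re]
    refine ⟨?_, ?_, ?_⟩ <;> linarith
  · rintro ⟨h1, h2, h3⟩
    -- Barycentric coordinates, solved from the last one: only `omega` has nonzero height, namely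
    -- 3/2.
    refine ⟨1 - z.re - ht z / 3, z.re - ht z / 3, 2 * ht z / 3, by linarith, by linarith,
      by linarith, by ring, ext_ht ?_ ?_⟩ <;>
    simp only [ht_add, ht_ofReal_mul, ht_omega, ht_zero, ht_one, Complex.add_re,
      Complex.re_ofReal_mul, omega_re, Complex.zero_re, Complex.one_re] <;> ring

/-- The third vertex of the triangle which one iteration raises over the unit segment. -/
noncomputable def apex : ℂ := 2 / 3 + omega / 3

theorem third_eq : (1 / 3 : ℂ) = ((1 / 3 : ℝ) : ℂ) := by push_cast; rfl
theorem two_thirds_eq : (2 / 3 : ℂ) = ((2 / 3 : ℝ) : ℂ) := by push_cast; rfl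

theorem apex_eq : apex = ((2 / 3 : ℝ) : ℂ) + ((1 / 3 : ℝ) : ℂ) * omega := by
  rw [apex]; push_cast; ring
theorem apex_re : apex.re = 5 / 6 := by
  rw [apex_eq, Complex.add_re, Complex.re_ofReal_mul, Complex.ofReal_re, omega_re]; norm_num
theorem ht_apex : ht apex = 1 / 2 := by
  rw [apex_eq, ht_add, ht_ofReal_mul, ht_ofReal, ht_omega]; norm_num

/-- The triangle which one iteration raises over the unit segment. -/
def core : Set ℂ := solidTriangle (1 / 3, apex, 2 / 3)

/-- The inequalities belong to the base and to the lines of the two slanted segments. Both lines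
have positive slope: the triangle is obtuse and leans to the right, its apex lying over 5/6. -/
theorem mem_core {z : ℂ} :
    z ∈ core ↔ 0 ≤ ht z ∧ ht z ≤ z.re - 1 / 3 ∧ 3 * z.re - 2 ≤ ht z := by
  rw [core, mem_solidTriangle, third_eq, two_thirds_eq]
  constructor
  · rintro ⟨a, b, c, ha, hb, hc, h, rfl⟩
    simp only [ht_add, ht_ofReal_mul, ht_apex, ht_ofReal, Complex.add_re,
      Complex.re_ofReal_mul, apex_re, Complex.ofReal_re]
    refine ⟨?_, ?_, ?_⟩ <;> linarith
  · rintro ⟨h1, h2, h3⟩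
    refine ⟨2 - 3 * z.re + ht z, 2 * ht z, 3 * z.re - 1 - 3 * ht z, by linarith, by linarith,
      by linarith, by ring, ext_ht ?_ ?_⟩ <;>
    simp only [ht_add, ht_ofReal_mul, ht_apex, ht_ofReal, Complex.add_re,
      Complex.re_ofReal_mul, apex_re, Complex.ofReal_re] <;> ring

/-- The interior of `core`. -/
def openCore : Set ℂ := {z | 0 < ht z ∧ ht z < z.re - 1 / 3 ∧ 3 * z.re - 2 < ht z}

theorem isOpen_openCore : IsOpen openCore :=
  (isOpen_lt continuous_const continuous_ht).inter
    ((isOpen_lt continuous_ht (by fun_prop)).inter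
      (isOpen_lt (by fun_prop) continuous_ht))

theorem openCore_subset_core : openCore ⊆ core := fun _ h =>
  mem_core.2 ⟨h.1.le, h.2.1.le, h.2.2.le⟩

/-- An open segment between a point of the interior of `core` and a point of `core` stays in the
interior. -/
theorem combination_mem_openCore {z w : ℂ} (hz : z ∈ core) (hw : w ∈ openCore) {a b : ℝ}
    (ha : 0 ≤ a) (hb : 0 < b) (hab : a + b = 1) : (a : ℂ) * z + b * w ∈ openCore := by
  obtain ⟨h1, h2, h3⟩ := mem_core.1 hz
  obtain ⟨k1, k2, k3⟩ := hw
  simp only [openCore, Set.mem_ofPred_eq, ht_add, ht_ofReal_mul, Complex.add_re,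
    Complex.re_ofReal_mul]
  have e1 := mul_nonneg ha h1
  have e2 := mul_nonneg ha (sub_nonneg.2 h2)
  have e3 := mul_nonneg ha (sub_nonneg.2 h3)
  have f1 := mul_pos hb k1
  have f2 := mul_pos hb (sub_pos.2 k2)
  have f3 := mul_pos hb (sub_pos.2 k3)
  obtain rfl : a = 1 - b := by linarith
  refine ⟨?_, ?_, ?_⟩ <;> linarith

/-- The barycenter of `core`. -/
noncomputable def coreCenter : ℂ := (2 / 3 : ℝ) + ((1 / 6 : ℝ) : ℂ) * (omega - (1 / 2 : ℝ))

theorem coreCenter_mem : coreCenter ∈ openCore := by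
  simp only [openCore, coreCenter, Set.mem_ofPred_eq, ht_add, ht_sub, ht_ofReal_mul, ht_ofReal,
    ht_omega, Complex.add_re, Complex.re_ofReal_mul, Complex.ofReal_re, Complex.sub_re, omega_re]
  norm_num

theorem core_subset_closure_openCore : core ⊆ closure openCore := by
  intro z hz
  have : Tendsto (fun t : ℝ => ((1 - t : ℝ) : ℂ) * z + t * coreCenter) (𝓝[>] 0)
      (𝓝 (((1 - 0 : ℝ) : ℂ) * z + (0 : ℝ) * coreCenter)) :=
    (Continuous.tendsto (by fun_prop) 0).mono_left nhdsWithin_le_nhds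
  simp only [sub_zero, Complex.ofReal_one, one_mul, Complex.ofReal_zero, zero_mul, add_zero] at this
  refine mem_closure_of_tendsto this ?_
  filter_upwards [Ioo_mem_nhdsGT (show (0 : ℝ) < 1 by norm_num)] with t ht
  exact combination_mem_openCore hz coreCenter_mem (by linarith [ht.2]) ht.1 (by ring)

theorem isCompact_solidTriangle (t : ℂ × ℂ × ℂ) : IsCompact (solidTriangle t) :=
  (Set.toFinite _).isCompact_convexHull ℝ

theorem core_subset_unitTriangle : core ⊆ unitTriangle := by
  intro z hz
  obtain ⟨h1, h2, h3⟩ := mem_core.1 hz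
  exact mem_unitTriangle.2 ⟨h1, by linarith, by linarith⟩

theorem convex_unitTriangle : Convex ℝ unitTriangle := convex_convexHull ℝ _

theorem zero_mem_unitTriangle : (0 : ℂ) ∈ unitTriangle :=
  mem_unitTriangle.2 (by simp [ht])
theorem one_mem_unitTriangle : (1 : ℂ) ∈ unitTriangle :=
  mem_unitTriangle.2 (by simp [ht])

theorem norm_le_two_of_mem_unitTriangle {z : ℂ} (h : z ∈ unitTriangle) : ‖z‖ ≤ 2 := by
  obtain ⟨h1, h2, h3⟩ := mem_unitTriangle.1 h
  rw [← abs_of_nonneg (norm_nonneg z), ← abs_of_nonneg (show (0 : ℝ) ≤ 2 by norm_num),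
    ← sq_le_sq, ← Complex.normSq_eq_norm_sq, normSq_eq_ht]
  nlinarith

/-! ### The segments of the polygonal curves -/

/-- The segments which replace the unit segment. -/
noncomputable def generator : List (ℂ × ℂ) := [(0, 1 / 3), (1 / 3, apex), (apex, 2 / 3), (2 / 3, 1)]

theorem replaceSegment_eq (s : ℂ × ℂ) : replaceSegment s = generator.map (simPair s) := by
  simp only [replaceSegment, generator, List.map_cons, List.map_nil, simPair, sim, apex]
  congr 1
  · congr 1 <;> ring
  · congr 1
    · congr 1 <;> ring
    · congr 1
      · congr 1 <;> ring
      · congr 2 <;> ring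

theorem mem_segments_succ {n : ℕ} {e : ℂ × ℂ} :
    e ∈ segments (n + 1) ↔ ∃ s ∈ segments n, ∃ g ∈ generator, simPair s g = e := by
  simp [segments, replaceSegment_eq]

theorem forall_mem_generator {p : ℂ × ℂ → Prop} : (∀ g ∈ generator, p g) ↔
    p (0, 1 / 3) ∧ p (1 / 3, apex) ∧ p (apex, 2 / 3) ∧ p (2 / 3, 1) := by
  simp [generator]

theorem generator_normSq {g : ℂ × ℂ} (hg : g ∈ generator) :
    0 < Complex.normSq (g.2 - g.1) ∧ Complex.normSq (g.2 - g.1) ≤ 1 / 3 := by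
  revert g
  rw [forall_mem_generator, third_eq, two_thirds_eq]
  simp only [normSq_eq_ht, ht_sub, Complex.sub_re, ht_apex, apex_re, ht_ofReal, Complex.ofReal_re,
    ht_zero, ht_one, Complex.zero_re, Complex.one_re]
  norm_num

/-- The longest piece has length 1/√3; 2/3 is a convenient rational bound, enough for diameters to
tend to 0. -/
theorem generator_norm {g : ℂ × ℂ} (hg : g ∈ generator) : ‖g.2 - g.1‖ ≤ 2 / 3 := by
  have := (generator_normSq hg).2
  rw [Complex.normSq_eq_norm_sq] at this
  nlinarith [norm_nonneg (g.2 - g.1)]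

theorem generator_ne {g : ℂ × ℂ} (hg : g ∈ generator) : g.1 ≠ g.2 := by
  have := (generator_normSq hg).1
  rw [Complex.normSq_pos, sub_ne_zero] at this
  exact this.symm

theorem ne_of_mem_segments {n : ℕ} {s : ℂ × ℂ} (hs : s ∈ segments n) : s.1 ≠ s.2 := by
  induction n generalizing s with
  | zero => simp only [segments, List.mem_singleton] at hs; subst hs; simp
  | succ n ih =>
    obtain ⟨r, hr, g, hg, rfl⟩ := mem_segments_succ.1 hs
    have h := simPair_sub r g
    have h1 := sub_ne_zero.2 (ih hr).symm
    have h2 := sub_ne_zero.2 (generator_ne hg).symm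
    exact (sub_ne_zero.1 (h ▸ mul_ne_zero h1 h2)).symm

theorem norm_le_of_mem_segments {n : ℕ} {s : ℂ × ℂ} (hs : s ∈ segments n) :
    ‖s.2 - s.1‖ ≤ (2 / 3) ^ n := by
  induction n generalizing s with
  | zero => simp only [segments, List.mem_singleton] at hs; subst hs; simp
  | succ n ih =>
    obtain ⟨r, hr, g, hg, rfl⟩ := mem_segments_succ.1 hs
    rw [simPair_sub, norm_mul, pow_succ]
    exact mul_le_mul (ih hr) (generator_norm hg) (norm_nonneg _) (by positivity)

/-- Three pieces contribute 1/9 each and the long one 1/3. This is the ratio of all the geometric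
area sums. -/
theorem sum_normSq_replaceSegment (s : ℂ × ℂ) :
    ((replaceSegment s).map fun e => Complex.normSq (e.2 - e.1)).sum =
      2 / 3 * Complex.normSq (s.2 - s.1) := by
  rw [replaceSegment_eq, generator, third_eq, two_thirds_eq]
  simp only [List.map_cons, List.map_nil, List.sum_cons, List.sum_nil, simPair_sub,
    Complex.normSq_mul]
  simp only [normSq_eq_ht (_ - _), ht_sub, Complex.sub_re, ht_apex, apex_re, ht_ofReal,
    Complex.ofReal_re, ht_zero, ht_one, Complex.zero_re, Complex.one_re]
  ring

theorem sum_map_flatMap {α : Type*} (l : List α) (f : α → List α) (g : α → ℝ) (c : ℝ)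
    (h : ∀ a ∈ l, ((f a).map g).sum = c * g a) :
    ((l.flatMap f).map g).sum = c * (l.map g).sum := by
  induction l with
  | nil => simp
  | cons a l ih =>
    simp only [List.flatMap_cons, List.map_append, List.sum_append, List.map_cons, List.sum_cons]
    rw [h a (by simp), ih fun b hb => h b (by simp [hb])]; ring

theorem sum_normSq_segments (n : ℕ) :
    ((segments n).map fun e => Complex.normSq (e.2 - e.1)).sum = (2 / 3) ^ n := by
  induction n with
  | zero => simp [segments]
  | succ n ih =>
    rw [segments, sum_map_flatMap _ _ _ (2 / 3) fun s _ => sum_normSq_replaceSegment s, ih]; ring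

/-- By convexity it suffices to check the vertices of the equilateral triangle left of each piece.
This is what makes the sets `cover n` decrease. -/
theorem sim_generator_mem_unitTriangle {g : ℂ × ℂ} (hg : g ∈ generator) {z : ℂ}
    (hz : z ∈ unitTriangle) : sim g z ∈ unitTriangle := by
  have hω : omega ∈ unitTriangle := subset_convexHull ℝ _ (by simp)
  suffices H : sim g 0 ∈ unitTriangle ∧ sim g 1 ∈ unitTriangle ∧ sim g omega ∈ unitTriangle by
    have hsub : sim g '' unitTriangle ⊆ unitTriangle := by
      rw [unitTriangle, sim_image_solidTriangle]
      refine convexHull_min ?_ convex_unitTriangle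
      rintro w (rfl | rfl | rfl)
      exacts [H.1, H.2.1, H.2.2]
    exact hsub ⟨z, hz, rfl⟩
  have key : ∀ g : ℂ × ℂ, sim g omega = g.1 + omega * (g.2 - g.1) := fun g => by
    rw [sim]; ring
  simp only [sim_zero, sim_one, key]
  clear hω hz
  revert g
  rw [forall_mem_generator, third_eq, two_thirds_eq]
  simp only [mem_unitTriangle, ht_add, ht_omega_mul, ht_sub, Complex.add_re, Complex.sub_re,
    re_omega_mul, ht_apex, apex_re, ht_ofReal, Complex.ofReal_re, ht_zero, ht_one, Complex.zero_re,
    Complex.one_re]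
  norm_num

theorem sim_image_unitTriangle_subset {n : ℕ} {s : ℂ × ℂ} (hs : s ∈ segments n) :
    sim s '' unitTriangle ⊆ unitTriangle := by
  induction n generalizing s with
  | zero =>
    simp only [segments, List.mem_singleton] at hs; subst hs
    rintro _ ⟨z, hz, rfl⟩; rwa [sim_unit]
  | succ n ih =>
    obtain ⟨r, hr, g, hg, rfl⟩ := mem_segments_succ.1 hs
    rintro _ ⟨z, hz, rfl⟩
    rw [sim_simPair]
    exact ih hr ⟨_, sim_generator_mem_unitTriangle hg hz, rfl⟩

/-! ### The filled curve -/

/-- The union of the triangles which the first `n` iterations raise. -/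
def filledAt (n : ℕ) : Set ℂ := ⋃ k < n, ⋃ s ∈ segments k, sim s '' core

/-- The closure of the union of the triangles which all iterations raise. -/
def filled : Set ℂ := closure (⋃ n, filledAt n)

theorem mem_filledAt {n : ℕ} {z : ℂ} :
    z ∈ filledAt n ↔ ∃ k < n, ∃ s ∈ segments k, z ∈ sim s '' core := by
  simp only [filledAt, Set.mem_iUnion, exists_prop]

theorem sim_core_subset_filled {n : ℕ} {s : ℂ × ℂ} (hs : s ∈ segments n) :
    sim s '' core ⊆ filled := fun _ hz =>
  subset_closure (Set.mem_iUnion.2 ⟨n + 1, mem_filledAt.2 ⟨n, n.lt_succ_self, s, hs, hz⟩⟩)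

theorem isClosed_filled : IsClosed filled := isClosed_closure

theorem filledAt_subset_filled (n : ℕ) : filledAt n ⊆ filled :=
  (Set.subset_iUnion _ n).trans subset_closure

theorem isCompact_unitTriangle : IsCompact unitTriangle := isCompact_solidTriangle _

theorem filled_subset_unitTriangle : filled ⊆ unitTriangle := by
  refine closure_minimal (Set.iUnion_subset fun n z hz => ?_) isCompact_unitTriangle.isClosed
  obtain ⟨k, -, s, hs, hz⟩ := mem_filledAt.1 hz
  exact sim_image_unitTriangle_subset hs (Set.image_mono core_subset_unitTriangle hz)

theorem isCompact_filledAt (n : ℕ) : IsCompact (filledAt n) := by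
  refine (Set.finite_lt_nat n).isCompact_biUnion fun k _ => ?_
  refine (List.finite_toSet (segments k)).isCompact_biUnion fun s _ => ?_
  exact (isCompact_solidTriangle _).image (continuous_sim s)

theorem sim_mem_of_segment_norm {n : ℕ} {s : ℂ × ℂ} (hs : s ∈ segments n) {z w : ℂ}
    (hz : z ∈ unitTriangle) (hw : w ∈ unitTriangle) :
    dist (sim s z) (sim s w) ≤ 4 * (2 / 3) ^ n := by
  rw [dist_sim]
  have h1 := norm_le_of_mem_segments hs
  have h2 : dist z w ≤ 4 := by
    have := norm_sub_le z w
    rw [← dist_eq_norm] at this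
    linarith [norm_le_two_of_mem_unitTriangle hz, norm_le_two_of_mem_unitTriangle hw]
  calc _ ≤ (2 / 3) ^ n * 4 := mul_le_mul h1 h2 dist_nonneg (by positivity)
    _ = _ := by ring

theorem tendsto_four_mul_pow : Tendsto (fun n : ℕ => 4 * (2 / 3 : ℝ) ^ n) atTop (𝓝 0) := by
  simpa using (tendsto_pow_atTop_nhds_zero_of_lt_one (r := (2 / 3 : ℝ)) (by norm_num)
    (by norm_num)).const_mul 4

theorem mem_closure_of_forall_pow {X : Set ℂ} {p : ℂ}
    (h : ∀ n : ℕ, ∃ q ∈ X, dist p q ≤ 4 * (2 / 3) ^ n) : p ∈ closure X := by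
  rw [Metric.mem_closure_iff]
  intro ε hε
  obtain ⟨n, hn⟩ := (tendsto_four_mul_pow.eventually (gt_mem_nhds hε)).exists
  obtain ⟨q, hq, hd⟩ := h n
  exact ⟨q, hq, hd.trans_lt hn⟩

/-- A point which at every level lies in the triangle over some segment is in `filled`. -/
theorem mem_filled_of_forall {p : ℂ} (h : ∀ n, ∃ s ∈ segments n, p ∈ sim s '' unitTriangle) :
    p ∈ filled := by
  rw [← isClosed_filled.closure_eq]
  refine mem_closure_of_forall_pow fun n => ?_
  obtain ⟨s, hs, z, hz, rfl⟩ := h n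
  exact ⟨sim s coreCenter, sim_core_subset_filled hs ⟨_, openCore_subset_core coreCenter_mem, rfl⟩,
    sim_mem_of_segment_norm hs hz (core_subset_unitTriangle (openCore_subset_core coreCenter_mem))⟩

/-- The triangles shrink and each contains an endpoint. Together with `curve_subset_cover` this
makes the curve the intersection of all `cover n`. -/
theorem mem_curve_of_forall {p : ℂ} (h : ∀ n, ∃ s ∈ segments n, p ∈ sim s '' unitTriangle) :
    p ∈ curve := by
  refine mem_closure_of_forall_pow fun n => ?_
  obtain ⟨s, hs, z, hz, rfl⟩ := h n
  refine ⟨s.1, Set.mem_iUnion.2 ⟨n, s, hs, .inl rfl⟩, ?_⟩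
  simpa using sim_mem_of_segment_norm hs hz zero_mem_unitTriangle

theorem endpoints_subset_succ (n : ℕ) : endpoints n ⊆ endpoints (n + 1) := by
  rintro z ⟨s, hs, h⟩
  rcases h with rfl | rfl
  · exact ⟨simPair s (0, 1 / 3), mem_segments_succ.2 ⟨s, hs, _, by simp [generator], rfl⟩,
      .inl (by simp [simPair])⟩
  · exact ⟨simPair s (2 / 3, 1), mem_segments_succ.2 ⟨s, hs, _, by simp [generator], rfl⟩,
      .inr (by simp [simPair])⟩

/-- The union of the triangles over the segments after `n` iterations. -/
def cover (n : ℕ) : Set ℂ := ⋃ s ∈ segments n, sim s '' unitTriangle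

theorem mem_cover {n : ℕ} {z : ℂ} : z ∈ cover n ↔ ∃ s ∈ segments n, z ∈ sim s '' unitTriangle := by
  simp only [cover, Set.mem_iUnion, exists_prop]

theorem isCompact_cover (n : ℕ) : IsCompact (cover n) :=
  (List.finite_toSet (segments n)).isCompact_biUnion fun s _ =>
    isCompact_unitTriangle.image (continuous_sim s)

theorem cover_antitone : Antitone cover := by
  refine antitone_nat_of_succ_le fun n z hz => ?_
  obtain ⟨e, he, w, hw, rfl⟩ := mem_cover.1 hz
  obtain ⟨s, hs, g, hg, rfl⟩ := mem_segments_succ.1 he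
  exact mem_cover.2 ⟨s, hs, sim g w, sim_generator_mem_unitTriangle hg hw, (sim_simPair _ _ _).symm⟩

theorem endpoints_subset_cover (n : ℕ) : endpoints n ⊆ cover n := by
  rintro z ⟨s, hs, rfl | rfl⟩
  · exact mem_cover.2 ⟨s, hs, 0, zero_mem_unitTriangle, by simp⟩
  · exact mem_cover.2 ⟨s, hs, 1, one_mem_unitTriangle, by simp⟩

theorem curve_subset_cover (n : ℕ) : curve ⊆ cover n := by
  refine closure_minimal (Set.iUnion_subset fun k => ?_) (isCompact_cover n).isClosed
  rcases le_total k n with h | h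
  · exact (monotone_nat_of_le_succ endpoints_subset_succ h).trans (endpoints_subset_cover n)
  · exact (endpoints_subset_cover k).trans (cover_antitone h)

theorem curve_subset_filled : curve ⊆ filled := fun _ hp =>
  mem_filled_of_forall fun n => mem_cover.1 (curve_subset_cover n hp)

/-- Everything raised from level n on stays inside `cover n`, and the right side is compact, so
taking the closure adds nothing more. -/
theorem filled_subset_union_cover (n : ℕ) : filled ⊆ filledAt n ∪ cover n := by
  refine closure_minimal (Set.iUnion_subset fun m z hz => ?_)
    ((isCompact_filledAt n).union (isCompact_cover n)).isClosed
  obtain ⟨k, hk, s, hs, hz⟩ := mem_filledAt.1 hz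
  rcases lt_or_ge k n with h | h
  · exact .inl (mem_filledAt.2 ⟨k, h, s, hs, hz⟩)
  · exact .inr (cover_antitone h
      (mem_cover.2 ⟨s, hs, Set.image_mono core_subset_unitTriangle hz⟩))

theorem filled_subset : filled ⊆ curve ∪ ⋃ n, filledAt n := by
  intro p hp
  by_contra hcon
  rw [Set.mem_union, not_or] at hcon
  obtain ⟨n, hn⟩ : ∃ n, p ∉ cover n := by
    by_contra! h
    exact hcon.1 (mem_curve_of_forall fun n => mem_cover.1 (h n))
  rcases filled_subset_union_cover n hp with h | h
  · exact hcon.2 (Set.mem_iUnion.2 ⟨n, h⟩)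
  · exact hn h

theorem mem_base_core {x : ℝ} (h1 : 1 / 3 ≤ x) (h2 : x ≤ 2 / 3) : (x : ℂ) ∈ core := by
  rw [mem_core, ht_ofReal, Complex.ofReal_re]
  exact ⟨le_rfl, by linarith, by linarith⟩

theorem sim_first (s : ℂ × ℂ) (z : ℂ) : sim (simPair s (0, 1 / 3)) z = sim s (z / 3) := by
  simp only [sim_simPair]; congr 1; simp only [sim]; ring

theorem sim_last (s : ℂ × ℂ) (z : ℂ) : sim (simPair s (2 / 3, 1)) z = sim s ((2 + z) / 3) := by
  simp only [sim_simPair]; congr 1; simp only [sim]; ring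

theorem first_mem {n : ℕ} {s : ℂ × ℂ} (hs : s ∈ segments n) :
    simPair s (0, 1 / 3) ∈ segments (n + 1) :=
  mem_segments_succ.2 ⟨s, hs, _, by simp [generator], rfl⟩
theorem second_mem {n : ℕ} {s : ℂ × ℂ} (hs : s ∈ segments n) :
    simPair s (1 / 3, apex) ∈ segments (n + 1) :=
  mem_segments_succ.2 ⟨s, hs, _, by simp [generator], rfl⟩
theorem third_mem {n : ℕ} {s : ℂ × ℂ} (hs : s ∈ segments n) :
    simPair s (apex, 2 / 3) ∈ segments (n + 1) :=
  mem_segments_succ.2 ⟨s, hs, _, by simp [generator], rfl⟩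
theorem last_mem {n : ℕ} {s : ℂ × ℂ} (hs : s ∈ segments n) :
    simPair s (2 / 3, 1) ∈ segments (n + 1) :=
  mem_segments_succ.2 ⟨s, hs, _, by simp [generator], rfl⟩

theorem ofReal_mem_unitTriangle {x : ℝ} (h0 : 0 ≤ x) (h1 : x ≤ 1) : (x : ℂ) ∈ unitTriangle := by
  rw [mem_unitTriangle, ht_ofReal, Complex.ofReal_re]
  exact ⟨le_rfl, by linarith, by linarith⟩

/-- Ternary subdivision: a point that falls into a middle third lies on the base of a raised
triangle. Otherwise it stays on a first or last third forever, hence under triangles of every level.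
-/
theorem ofReal_mem_filled {x : ℝ} (h0 : 0 ≤ x) (h1 : x ≤ 1) : (x : ℂ) ∈ filled := by
  by_contra hx
  have key : ∀ n, ∃ s ∈ segments n, ∃ y : ℝ, 0 ≤ y ∧ y ≤ 1 ∧ sim s y = x := by
    intro n
    induction n with
    | zero => exact ⟨(0, 1), by simp [segments], x, h0, h1, sim_unit _⟩
    | succ n ih =>
      obtain ⟨s, hs, y, hy0, hy1, hy⟩ := ih
      rcases le_total y (1 / 3) with h | h
      · refine ⟨_, first_mem hs, 3 * y, by linarith, by linarith, ?_⟩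
        rw [sim_first, ← hy]; push_cast; congr 1; ring
      rcases le_total y (2 / 3) with h' | h'
      · exact absurd (hy ▸ sim_core_subset_filled hs ⟨_, mem_base_core h h', rfl⟩) hx
      · refine ⟨_, last_mem hs, 3 * y - 2, by linarith, by linarith, ?_⟩
        rw [sim_last, ← hy]; push_cast; congr 1; ring
  refine hx (mem_filled_of_forall fun n => ?_)
  obtain ⟨s, hs, y, hy0, hy1, hy⟩ := key n
  exact ⟨s, hs, y, ofReal_mem_unitTriangle hy0 hy1, hy⟩

/-! ### Left and right neighborhoods of the segments -/

/-- `X` contains a neighborhood of `sim s x` in the closed half plane left of `s`. -/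
def LeftNhd (X : Set ℂ) (s : ℂ × ℂ) (x : ℝ) : Prop :=
  ∃ ε > 0, ∀ z : ℂ, ‖z‖ < ε → 0 ≤ ht z → sim s (x + z) ∈ X

/-- `X` contains a neighborhood of `sim s x` in the closed half plane right of `s`. -/
def RightNhd (X : Set ℂ) (s : ℂ × ℂ) (x : ℝ) : Prop :=
  ∃ ε > 0, ∀ z : ℂ, ‖z‖ < ε → ht z ≤ 0 → sim s (x + z) ∈ X

theorem mem_nhds_of_leftNhd_of_rightNhd {X : Set ℂ} {s : ℂ × ℂ} (hs : s.1 ≠ s.2) {x : ℝ}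
    (hl : LeftNhd X s x) (hr : RightNhd X s x) : X ∈ 𝓝 (sim s x) := by
  obtain ⟨ε, hε, h1⟩ := hl
  obtain ⟨δ, hδ, h2⟩ := hr
  have : sim s ⁻¹' X ∈ 𝓝 (x : ℂ) := by
    filter_upwards [Metric.ball_mem_nhds (x : ℂ) (lt_min hε hδ)] with w hw
    rw [Metric.mem_ball, dist_eq_norm, lt_min_iff] at hw
    have e : (x : ℂ) + (w - x) = w := by ring
    rcases le_total 0 (ht (w - x)) with h | h
    · simpa [e] using h1 _ hw.1 h
    · simpa [e] using h2 _ hw.2 h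
  have h3 := (simHomeomorph hs).isOpenMap.image_mem_nhds this
  rw [coe_simHomeomorph] at h3
  exact mem_of_superset h3 (Set.image_preimage_subset _ _)

theorem norm_div_three_lt {z : ℂ} {ε : ℝ} (h : ‖z‖ < 3 * ε) : ‖z / 3‖ < ε := by
  rw [norm_div]; norm_num; linarith

theorem ht_div_three (z : ℂ) : ht (z / 3) = ht z / 3 := by
  rw [show z / 3 = ((1 / 3 : ℝ) : ℂ) * z by push_cast; ring, ht_ofReal_mul]; ring

theorem LeftNhd.mono {X Y : Set ℂ} (h : X ⊆ Y) {s : ℂ × ℂ} {x : ℝ} (hx : LeftNhd X s x) :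
    LeftNhd Y s x := by
  obtain ⟨ε, hε, h'⟩ := hx
  exact ⟨ε, hε, fun z h1 h2 => h (h' z h1 h2)⟩

theorem three_mul_norm_lt {z : ℂ} {ε : ℝ} (h : ‖z‖ < ε / 3) : ‖3 * z‖ < ε := by
  rw [norm_mul]; norm_num; linarith

theorem ht_three_mul (z : ℂ) : ht (3 * z) = 3 * ht z := by
  rw [show 3 * z = ((3 : ℝ) : ℂ) * z by push_cast; ring, ht_ofReal_mul]

theorem leftNhd_first {X : Set ℂ} {s : ℂ × ℂ} {x : ℝ}
    (h : LeftNhd X (simPair s (0, 1 / 3)) (3 * x)) : LeftNhd X s x := by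
  obtain ⟨ε, hε, h'⟩ := h
  refine ⟨ε / 3, by positivity, fun z h1 h2 => ?_⟩
  have := h' (3 * z) (three_mul_norm_lt h1) (by rw [ht_three_mul]; positivity)
  rw [sim_first] at this
  convert this using 2
  push_cast; ring

theorem leftNhd_last {X : Set ℂ} {s : ℂ × ℂ} {x : ℝ}
    (h : LeftNhd X (simPair s (2 / 3, 1)) (3 * x - 2)) : LeftNhd X s x := by
  obtain ⟨ε, hε, h'⟩ := h
  refine ⟨ε / 3, by positivity, fun z h1 h2 => ?_⟩
  have := h' (3 * z) (three_mul_norm_lt h1) (by rw [ht_three_mul]; positivity)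
  rw [sim_last] at this
  convert this using 2
  push_cast; ring

theorem rightNhd_first {X : Set ℂ} {s : ℂ × ℂ} {x : ℝ}
    (h : RightNhd X s (x / 3)) : RightNhd X (simPair s (0, 1 / 3)) x := by
  obtain ⟨ε, hε, h'⟩ := h
  refine ⟨3 * ε, by positivity, fun z h1 h2 => ?_⟩
  have := h' (z / 3) (norm_div_three_lt h1) (by rw [ht_div_three]; linarith)
  rw [sim_first]
  convert this using 2
  push_cast; ring

theorem rightNhd_last {X : Set ℂ} {s : ℂ × ℂ} {x : ℝ}
    (h : RightNhd X s ((2 + x) / 3)) : RightNhd X (simPair s (2 / 3, 1)) x := by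
  obtain ⟨ε, hε, h'⟩ := h
  refine ⟨3 * ε, by positivity, fun z h1 h2 => ?_⟩
  have := h' (z / 3) (norm_div_three_lt h1) (by rw [ht_div_three]; linarith)
  rw [sim_last]
  convert this using 2
  push_cast; ring

theorem norm_bounds {z : ℂ} {ε : ℝ} (h : ‖z‖ < ε) :
    -ε < z.re ∧ z.re < ε ∧ -(2 * ε) < ht z ∧ ht z < 2 * ε := by
  have h1 := abs_le.1 ((Complex.abs_re_le_norm z).trans h.le)
  have h2 := abs_lt.1 ((Complex.abs_re_le_norm z).trans_lt h)
  have h3 := abs_lt.1 ((abs_ht_le z).trans_lt (mul_lt_mul_of_pos_left h two_pos))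
  exact ⟨h2.1, h2.2, h3.1, h3.2⟩

/-- A point in the middle third of a segment is a boundary point of the triangle on its left. -/
theorem leftNhd_core {s : ℂ × ℂ} {x : ℝ} (h1 : 1 / 3 < x) (h2 : x < 2 / 3) :
    LeftNhd (sim s '' core) s x := by
  refine ⟨min (x - 1 / 3) (2 / 3 - x) / 4, by
    have := lt_min (sub_pos.2 h1) (sub_pos.2 h2); positivity, fun z hz h0 => ⟨_, ?_, rfl⟩⟩
  have e1 := min_le_left (x - 1 / 3) (2 / 3 - x)
  have e2 := min_le_right (x - 1 / 3) (2 / 3 - x)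
  obtain ⟨b1, b2, b3, b4⟩ := norm_bounds hz
  rw [mem_core, ht_add, ht_ofReal, Complex.add_re, Complex.ofReal_re]
  refine ⟨by linarith, by linarith, by linarith⟩

theorem sim_second_eq (z : ℂ) :
    sim (1 / 3, apex) z = (1 / 3 : ℝ) + ((1 / 3 : ℝ) : ℂ) * (z + omega * z) := by
  simp only [sim, apex]; push_cast; ring

theorem sim_third_eq (z : ℂ) :
    sim (apex, 2 / 3) z = (2 / 3 : ℝ) + ((1 / 3 : ℝ) : ℂ) * (omega - omega * z) := by
  simp only [sim, apex]; push_cast; ring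

theorem sim_second_mem_core {z : ℂ} : sim (1 / 3, apex) z ∈ core ↔
    ht z ≤ 0 ∧ -ht z ≤ z.re ∧ -ht z ≤ 1 - z.re := by
  rw [mem_core, sim_second_eq]
  simp only [ht_add, ht_ofReal_mul, ht_omega_mul, re_omega_mul, Complex.add_re,
    Complex.re_ofReal_mul, Complex.ofReal_re, ht_ofReal]
  constructor <;> rintro ⟨h1, h2, h3⟩ <;> refine ⟨?_, ?_, ?_⟩ <;> linarith

theorem sim_third_mem_core {z : ℂ} : sim (apex, 2 / 3) z ∈ core ↔
    ht z ≤ 0 ∧ -ht z ≤ z.re ∧ ht z ≤ 3 - 3 * z.re := by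
  rw [mem_core, sim_third_eq]
  simp only [ht_add, ht_sub, ht_ofReal_mul, ht_omega_mul, re_omega_mul, Complex.add_re,
    Complex.sub_re, Complex.re_ofReal_mul, Complex.ofReal_re, ht_ofReal, ht_omega, omega_re]
  constructor <;> rintro ⟨h1, h2, h3⟩ <;> refine ⟨?_, ?_, ?_⟩ <;> linarith

theorem rightNhd_second {s : ℂ × ℂ} {x : ℝ} (h0 : 0 < x) (h1 : x < 1) :
    RightNhd (sim s '' core) (simPair s (1 / 3, apex)) x := by
  refine ⟨min x (1 - x) / 4, by
    have := lt_min h0 (sub_pos.2 h1); positivity, fun z hz hz0 => ?_⟩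
  have e1 := min_le_left x (1 - x)
  have e2 := min_le_right x (1 - x)
  obtain ⟨b1, b2, b3, b4⟩ := norm_bounds hz
  refine ⟨_, ?_, (sim_simPair _ _ _).symm⟩
  rw [sim_second_mem_core, ht_add, ht_ofReal, Complex.add_re, Complex.ofReal_re]
  refine ⟨by linarith, by linarith, by linarith⟩

theorem rightNhd_third {s : ℂ × ℂ} {x : ℝ} (h0 : 0 < x) (h1 : x < 1) :
    RightNhd (sim s '' core) (simPair s (apex, 2 / 3)) x := by
  refine ⟨min x (1 - x) / 4, by
    have := lt_min h0 (sub_pos.2 h1); positivity, fun z hz hz0 => ?_⟩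
  have e1 := min_le_left x (1 - x)
  have e2 := min_le_right x (1 - x)
  obtain ⟨b1, b2, b3, b4⟩ := norm_bounds hz
  refine ⟨_, ?_, (sim_simPair _ _ _).symm⟩
  rw [sim_third_mem_core, ht_add, ht_ofReal, Complex.add_re, Complex.ofReal_re]
  refine ⟨by linarith, by linarith, by linarith⟩

theorem RightNhd.mono {X Y : Set ℂ} (h : X ⊆ Y) {s : ℂ × ℂ} {x : ℝ} (hx : RightNhd X s x) :
    RightNhd Y s x := by
  obtain ⟨ε, hε, h'⟩ := hx
  exact ⟨ε, hε, fun z h1 h2 => h (h' z h1 h2)⟩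

/-- The points below the base line. -/
def lowerHalf : Set ℂ := {z | ht z < 0}

theorem eq_ofReal_of_ht_eq_zero {z : ℂ} (h : ht z = 0) : z = (z.re : ℂ) :=
  ext_ht (by simp) (by rw [h, ht_ofReal])

/-- The two slanted pieces run clockwise around the triangle just raised, which is therefore on
their right. The first and last pieces lie on the parent segment and inherit its right side; the
recursion ends at the base, with `lowerHalf` below it. -/
theorem rightNhd_filled {n : ℕ} {s : ℂ × ℂ} (hs : s ∈ segments n) {x : ℝ} (h0 : 0 < x)
    (h1 : x < 1) : RightNhd (filled ∪ lowerHalf) s x := by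
  induction n generalizing s x with
  | zero =>
    simp only [segments, List.mem_singleton] at hs; subst hs
    refine ⟨min x (1 - x), lt_min h0 (sub_pos.2 h1), fun z hz hz0 => ?_⟩
    have e1 := min_le_left x (1 - x)
    have e2 := min_le_right x (1 - x)
    obtain ⟨b1, b2, -, -⟩ := norm_bounds hz
    rw [sim_unit]
    rcases hz0.lt_or_eq with h | h
    · exact .inr (by rw [lowerHalf, Set.mem_ofPred_eq, ht_add, ht_ofReal]; linarith)
    · left
      rw [eq_ofReal_of_ht_eq_zero h, ← Complex.ofReal_add]
      exact ofReal_mem_filled (by linarith) (by linarith)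
  | succ n ih =>
    obtain ⟨r, hr, g, hg, rfl⟩ := mem_segments_succ.1 hs
    have hsub : sim r '' core ⊆ filled ∪ lowerHalf :=
      (sim_core_subset_filled hr).trans Set.subset_union_left
    simp only [generator, List.mem_cons, List.not_mem_nil, or_false] at hg
    rcases hg with rfl | rfl | rfl | rfl
    · exact rightNhd_first (ih hr (by linarith) (by linarith))
    · exact (rightNhd_second h0 h1).mono hsub
    · exact (rightNhd_third h0 h1).mono hsub
    · exact rightNhd_last (ih hr (by linarith) (by linarith))

theorem mem_nhds_of_leftNhd {n : ℕ} {s : ℂ × ℂ} (hs : s ∈ segments n) {x : ℝ} (h0 : 0 < x)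
    (h1 : x < 1) (h : LeftNhd filled s x) : filled ∪ lowerHalf ∈ 𝓝 (sim s x) :=
  mem_nhds_of_leftNhd_of_rightNhd (ne_of_mem_segments hs) (h.mono Set.subset_union_left)
    (rightNhd_filled hs h0 h1)

theorem endpoint_mem_curve {n : ℕ} {s : ℂ × ℂ} (hs : s ∈ segments n) :
    s.1 ∈ curve ∧ s.2 ∈ curve :=
  ⟨subset_closure (Set.mem_iUnion.2 ⟨n, s, hs, .inl rfl⟩),
    subset_closure (Set.mem_iUnion.2 ⟨n, s, hs, .inr rfl⟩)⟩

/-- In an open middle third the raised triangle is the left neighborhood. A point without one thus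
passes to a first or last third at every level, which puts it on the curve. -/
theorem leftNhd_of_notMem_curve {n : ℕ} {s : ℂ × ℂ} (hs : s ∈ segments n) {x : ℝ} (h0 : 0 ≤ x)
    (h1 : x ≤ 1) (hx : sim s x ∉ curve) : LeftNhd filled s x := by
  by_contra hcon
  have key : ∀ m, ∃ e ∈ segments (n + m), ∃ y : ℝ, 0 ≤ y ∧ y ≤ 1 ∧ sim e y = sim s x ∧
      ¬ LeftNhd filled e y := by
    intro m
    induction m with
    | zero => exact ⟨s, hs, x, h0, h1, rfl, hcon⟩
    | succ m ih =>
      obtain ⟨e, he, y, hy0, hy1, hy, hn⟩ := ih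
      -- The values 1/3 and 2/3 go to the outer thirds: at a corner `core` does not fill the left
      -- half plane.
      rcases le_or_gt y (1 / 3) with h | h
      · refine ⟨_, first_mem he, 3 * y, by linarith, by linarith, ?_,
          fun h' => hn (leftNhd_first h')⟩
        rw [sim_first, ← hy]; push_cast; congr 1; ring
      rcases lt_or_ge y (2 / 3) with h' | h'
      · exact absurd ((leftNhd_core h h').mono (sim_core_subset_filled he)) hn
      · refine ⟨_, last_mem he, 3 * y - 2, by linarith, by linarith, ?_,
          fun h' => hn (leftNhd_last h')⟩
        rw [sim_last, ← hy]; push_cast; congr 1; ring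
  refine hx (mem_curve_of_forall fun m => ?_)
  obtain ⟨e, he, y, hy0, hy1, hy, -⟩ := key m
  exact mem_cover.1 (cover_antitone (Nat.le_add_left m n)
    (mem_cover.2 ⟨e, he, y, ofReal_mem_unitTriangle hy0 hy1, hy⟩))

/-- A point of `core` is an interior point or lies on one of its three sides. -/
theorem mem_core_cases {z : ℂ} (hz : z ∈ core) : z ∈ openCore ∨
    ∃ x : ℝ, 0 ≤ x ∧ x ≤ 1 ∧ (z = x ∨ z = sim (1 / 3, apex) x ∨ z = sim (apex, 2 / 3) x) := by
  obtain ⟨h1, h2, h3⟩ := mem_core.1 hz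
  rcases h1.lt_or_eq with k1 | k1
  swap
  · exact .inr ⟨z.re, by linarith, by linarith, .inl (eq_ofReal_of_ht_eq_zero k1.symm)⟩
  rcases h2.lt_or_eq with k2 | k2
  swap
  · refine .inr ⟨2 * ht z, by linarith, by linarith, .inr (.inl (ext_ht ?_ ?_))⟩ <;>
    simp only [sim_second_eq, ht_add, ht_ofReal_mul, ht_omega_mul, re_omega_mul, Complex.add_re,
      Complex.re_ofReal_mul, Complex.ofReal_re, ht_ofReal] <;> linarith
  rcases h3.lt_or_eq with k3 | k3
  swap
  · refine .inr ⟨1 - 2 * ht z, by linarith, by linarith, .inr (.inr (ext_ht ?_ ?_))⟩ <;>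
    simp only [sim_third_eq, ht_add, ht_sub, ht_ofReal_mul, ht_omega_mul, re_omega_mul,
      Complex.add_re, Complex.sub_re, Complex.re_ofReal_mul, Complex.ofReal_re, ht_ofReal,
      ht_omega, omega_re] <;> linarith
  exact .inl ⟨k1, k2, k3⟩

theorem ofReal_mem_segment {x : ℝ} (h0 : 0 ≤ x) (h1 : x ≤ 1) : (x : ℂ) ∈ segment ℝ (0 : ℂ) 1 :=
  ⟨1 - x, x, by linarith, h0, by ring, by simp⟩

/-- The boundary of `filled` lies on the curve and its base. -/
theorem mem_interior_filled {p : ℂ} (hp : p ∈ filled) (hc : p ∉ curve)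
    (hb : p ∉ segment ℝ (0 : ℂ) 1) : p ∈ interior filled := by
  have hpos : 0 < ht p := by
    obtain ⟨h1, h2, h3⟩ := mem_unitTriangle.1 (filled_subset_unitTriangle hp)
    refine h1.lt_of_ne fun h => hb ?_
    rw [eq_ofReal_of_ht_eq_zero h.symm]
    exact ofReal_mem_segment (by linarith) (by linarith)
  rw [mem_interior_iff_mem_nhds]
  have key : ∀ {n : ℕ} {s : ℂ × ℂ} {x : ℝ}, s ∈ segments n → 0 ≤ x → x ≤ 1 → p = sim s x →
      filled ∈ 𝓝 p := by
    rintro n s x hs h0 h1 rfl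
    have h0' : 0 < x := h0.lt_of_ne (by
      rintro rfl; exact hc (by simpa using (endpoint_mem_curve hs).1))
    have h1' : x < 1 := h1.lt_of_ne (by
      rintro rfl; exact hc (by simpa using (endpoint_mem_curve hs).2))
    -- As p is strictly above the base, points of `lowerHalf` are excluded near it.
    filter_upwards [mem_nhds_of_leftNhd hs h0' h1' (leftNhd_of_notMem_curve hs h0 h1 hc),
      (isOpen_lt continuous_const continuous_ht).mem_nhds hpos] with z hz hz'
    exact hz.resolve_right fun h => lt_asymm h hz'
  obtain ⟨N, hN⟩ := Set.mem_iUnion.1 ((filled_subset hp).resolve_left hc)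
  obtain ⟨n, -, s, hs, z, hz, rfl⟩ := mem_filledAt.1 hN
  rcases mem_core_cases hz with h | ⟨x, h0, h1, h | h | h⟩
  · refine mem_of_superset ((simHomeomorph (ne_of_mem_segments hs)).isOpenMap _ isOpen_openCore
      |>.mem_nhds ⟨z, h, rfl⟩) ?_
    exact (Set.image_mono openCore_subset_core).trans (sim_core_subset_filled hs)
  · exact key hs h0 h1 (by rw [h])
  · exact key (second_mem hs) h0 h1 (by rw [h, sim_simPair])
  · exact key (third_mem hs) h0 h1 (by rw [h, sim_simPair])

/-- What the curve and its base enclose contains `filled`. -/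
theorem filled_subset_waveRegion : filled ⊆ waveRegion := by
  intro p hp
  by_cases hS : p ∈ curve ∪ segment ℝ 0 1
  · exact .inl hS
  refine .inr ⟨hS, isCompact_unitTriangle.isBounded.subset ?_⟩
  set C := connectedComponentIn (curve ∪ segment ℝ (0 : ℂ) 1)ᶜ p with hC
  have hint : ∀ q ∈ filled, q ∈ (curve ∪ segment ℝ (0 : ℂ) 1)ᶜ → q ∈ interior filled :=
    fun q hq hq' => mem_interior_filled hq (fun h => hq' (.inl h)) (fun h => hq' (.inr h))
  have : C ⊆ interior filled := by
    -- The interior of `filled` is open and closed relative to the component, because boundary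
    -- points of `filled` lie on the curve or the base.
    refine isPreconnected_connectedComponentIn.subset_of_closure_inter_subset isOpen_interior
      ⟨p, mem_connectedComponentIn hS, hint p hp hS⟩ ?_
    rintro q ⟨hq, hqC⟩
    exact hint q (closure_minimal interior_subset isClosed_filled hq)
      (connectedComponentIn_subset _ _ hqC)
  exact this.trans (interior_subset.trans filled_subset_unitTriangle)

theorem curve_union_segment_subset_filled : curve ∪ segment ℝ 0 1 ⊆ filled := by
  refine Set.union_subset curve_subset_filled ?_
  rintro _ ⟨a, b, ha, hb, hab, rfl⟩
  have := ofReal_mem_filled hb (by linarith)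
  simpa using this

/-! ### Areas -/

theorem volume_affine_image (L : ℂ →ₗ[ℝ] ℂ) (a : ℂ) (X : Set ℂ) :
    volume ((fun z => a + L z) '' X) = ENNReal.ofReal |LinearMap.det L| * volume X := by
  have : (fun z => a + L z) '' X = (fun z => a + z) '' (L '' X) := by
    rw [Set.image_image]
  rw [this, Set.image_add_left, measure_preimage_add, Measure.addHaar_image_linearMap]

theorem volume_real_affine_image (L : ℂ →ₗ[ℝ] ℂ) (a : ℂ) (X : Set ℂ) :
    volume.real ((fun z => a + L z) '' X) = |LinearMap.det L| * volume.real X := by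
  rw [measureReal_def, volume_affine_image, ENNReal.toReal_mul,
    ENNReal.toReal_ofReal (abs_nonneg _), measureReal_def]

theorem volume_sim_image_eq_zero (s : ℂ × ℂ) {X : Set ℂ} (hX : volume X = 0) :
    volume (sim s '' X) = 0 := by
  have h := volume_affine_image (Algebra.lmul ℝ ℂ (s.2 - s.1)) s.1 X
  rw [hX, mul_zero] at h
  exact h

theorem volume_real_sim_image (s : ℂ × ℂ) (X : Set ℂ) :
    volume.real (sim s '' X) = Complex.normSq (s.2 - s.1) * volume.real X := by
  have h := volume_real_affine_image (Algebra.lmul ℝ ℂ (s.2 - s.1)) s.1 X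
  rw [← Algebra.norm_apply, Algebra.norm_complex_apply, abs_of_nonneg (Complex.normSq_nonneg _)] at h
  exact h

/-- The real linear map which takes `1` to `u` and `I` to `v`. -/
noncomputable def frame (u v : ℂ) : ℂ →ₗ[ℝ] ℂ := Complex.reLm.smulRight u + Complex.imLm.smulRight v

theorem frame_apply (u v z : ℂ) : frame u v z = z.re * u + z.im * v := by
  simp [frame]

theorem det_frame (u v : ℂ) : LinearMap.det (frame u v) = u.re * v.im - u.im * v.re := by
  rw [← LinearMap.det_toMatrix Complex.basisOneI, Matrix.det_fin_two]
  simp [LinearMap.toMatrix_apply, frame_apply]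
  ring

theorem mem_standardTriangle {z : ℂ} :
    z ∈ solidTriangle (0, 1, Complex.I) ↔ 0 ≤ z.re ∧ 0 ≤ z.im ∧ z.re + z.im ≤ 1 := by
  rw [mem_solidTriangle]
  constructor
  · rintro ⟨a, b, c, ha, hb, hc, h, rfl⟩
    simp
    exact ⟨hb, hc, by linarith⟩
  · rintro ⟨h1, h2, h3⟩
    exact ⟨1 - z.re - z.im, z.re, z.im, by linarith, h1, h2, by ring,
      Complex.ext (by simp) (by simp)⟩

theorem volume_real_standardTriangle : volume.real (solidTriangle (0, 1, Complex.I)) = 1 / 2 := by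
  set D : Set (ℝ × ℝ) := {p | 0 ≤ p.1 ∧ 0 ≤ p.2 ∧ p.1 + p.2 ≤ 1} with hD
  have hDm : MeasurableSet D := by
    refine IsClosed.measurableSet ?_
    exact (isClosed_le continuous_const continuous_fst).inter
      ((isClosed_le continuous_const continuous_snd).inter
        (isClosed_le (continuous_fst.add continuous_snd) continuous_const))
  have e : solidTriangle (0, 1, Complex.I) = Complex.measurableEquivRealProd ⁻¹' D := by
    ext z; rw [mem_standardTriangle]; rfl
  rw [e, measureReal_def,
    Complex.volume_preserving_equiv_real_prod.measure_preimage hDm.nullMeasurableSet,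
    Measure.volume_eq_prod, Measure.prod_apply hDm]
  have slice : ∀ x : ℝ, volume (Prod.mk x ⁻¹' D) =
      (Set.Icc (0 : ℝ) 1).indicator (fun x => ENNReal.ofReal (1 - x)) x := by
    intro x
    by_cases hx : x ∈ Set.Icc (0 : ℝ) 1
    · rw [Set.indicator_of_mem hx]
      have : Prod.mk x ⁻¹' D = Set.Icc 0 (1 - x) := by
        ext y
        simp only [hD, Set.mem_preimage, Set.mem_ofPred_eq, Set.mem_Icc]
        exact ⟨fun h => ⟨h.2.1, by linarith⟩, fun h => ⟨hx.1, h.1, by linarith⟩⟩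
      rw [this, Real.volume_Icc, sub_zero]
    · rw [Set.indicator_of_notMem hx]
      have : Prod.mk x ⁻¹' D = ∅ := by
        ext y
        simp only [hD, Set.mem_preimage, Set.mem_ofPred_eq, Set.mem_empty_iff_false, iff_false]
        exact fun h => hx ⟨h.1, by linarith⟩
      rw [this, measure_empty]
  have hI : ∫ x in (0 : ℝ)..1, (1 - x) = 1 / 2 := by
    rw [intervalIntegral.integral_sub (by simp) (by simp), integral_id]; norm_num
  rw [lintegral_congr slice, lintegral_indicator measurableSet_Icc,
    ← ofReal_integral_eq_lintegral_ofReal]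
  · rw [integral_Icc_eq_integral_Ioc, ← intervalIntegral.integral_of_le zero_le_one,
      ENNReal.toReal_ofReal]
    · rw [hI]
    · rw [hI]; norm_num
  · exact (by fun_prop : Continuous fun x : ℝ => 1 - x).continuousOn.integrableOn_Icc
  · filter_upwards [ae_restrict_mem measurableSet_Icc] with x hx
    exact sub_nonneg.2 hx.2

theorem volume_real_solidTriangle (P Q R : ℂ) : volume.real (solidTriangle (P, Q, R)) =
    |(Q - P).re * (R - P).im - (Q - P).im * (R - P).re| / 2 := by
  have : solidTriangle (P, Q, R) =
      (fun z => P + frame (Q - P) (R - P) z) '' solidTriangle (0, 1, Complex.I) := by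
    ext z
    simp only [Set.mem_image, mem_solidTriangle, frame_apply]
    constructor
    · rintro ⟨a, b, c, ha, hb, hc, h, rfl⟩
      refine ⟨_, ⟨a, b, c, ha, hb, hc, h, rfl⟩, ?_⟩
      have h' : (a : ℂ) + b + c = 1 := by exact_mod_cast h
      simp
      linear_combination -P * h'
    · rintro ⟨_, ⟨a, b, c, ha, hb, hc, h, rfl⟩, rfl⟩
      refine ⟨a, b, c, ha, hb, hc, h, ?_⟩
      have h' : (a : ℂ) + b + c = 1 := by exact_mod_cast h
      simp
      linear_combination -P * h'
  rw [this, volume_real_affine_image, volume_real_standardTriangle, det_frame]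
  ring

theorem volume_real_unitTriangle : volume.real unitTriangle = √3 / 4 := by
  rw [unitTriangle, volume_real_solidTriangle]
  simp only [sub_zero, Complex.one_re, Complex.one_im, omega_re, omega_im]
  rw [abs_of_nonneg (by simp; positivity)]; ring

theorem volume_real_core : volume.real core = √3 / 36 := by
  have him : apex.im = √3 / 6 := by
    rw [apex_eq, Complex.add_im, Complex.im_ofReal_mul, Complex.ofReal_im, omega_im]; ring
  rw [core, volume_real_solidTriangle, third_eq, two_thirds_eq]
  simp only [Complex.sub_re, Complex.sub_im, apex_re, Complex.ofReal_re, Complex.ofReal_im, him]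
  rw [show (5 / 6 - 1 / 3) * (0 - 0) - (√3 / 6 - 0) * (2 / 3 - 1 / 3 : ℝ) = -(√3 / 18) by ring,
    abs_neg, abs_of_nonneg (by positivity)]
  ring

theorem volume_ne_top_of_isBounded {X : Set ℂ} (h : Bornology.IsBounded X) :
    volume X ≠ ⊤ := h.measure_lt_top.ne

theorem volume_real_biUnion_le {α : Type*} (l : List α) (f : α → Set ℂ) :
    volume.real (⋃ a ∈ l, f a) ≤ (l.map fun a => volume.real (f a)).sum := by
  induction l with
  | nil => simp
  | cons a l ih =>
    have : (⋃ b ∈ a :: l, f b) = f a ∪ ⋃ b ∈ l, f b := by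
      ext z; simp
    rw [this, List.map_cons, List.sum_cons]
    exact (measureReal_union_le _ _).trans (by gcongr)

theorem volume_real_biUnion_sim_le (n : ℕ) (X : Set ℂ) :
    volume.real (⋃ s ∈ segments n, sim s '' X) ≤ (2 / 3) ^ n * volume.real X := by
  refine (volume_real_biUnion_le _ _).trans_eq ?_
  simp only [volume_real_sim_image, List.sum_map_mul_right, sum_normSq_segments]

/-- Subadditivity and the geometric sum of √3/36·(2/3)^k. The reverse inequality is obtained only
from the covering of the unit triangle. -/
theorem volume_real_filledAt_le (n : ℕ) :
    volume.real (filledAt n) ≤ √3 / 12 * (1 - (2 / 3) ^ n) := by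
  induction n with
  | zero => simp [filledAt]
  | succ n ih =>
    have : filledAt (n + 1) = filledAt n ∪ ⋃ s ∈ segments n, sim s '' core := by
      ext z
      simp only [mem_filledAt, Set.mem_union, Set.mem_iUnion, exists_prop, Nat.lt_succ_iff_lt_or_eq]
      constructor
      · rintro ⟨k, h | rfl, h'⟩
        exacts [.inl ⟨k, h, h'⟩, .inr h']
      · rintro (⟨k, h, h'⟩ | h')
        exacts [⟨k, .inl h, h'⟩, ⟨n, .inr rfl, h'⟩]
    rw [this]
    refine (measureReal_union_le _ _).trans ((add_le_add ih
      (volume_real_biUnion_sim_le n core)).trans_eq ?_)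
    rw [volume_real_core]; ring

theorem filledAt_mono : Monotone filledAt := fun m n h z hz => by
  obtain ⟨k, hk, hs⟩ := mem_filledAt.1 hz
  exact mem_filledAt.2 ⟨k, hk.trans_le h, hs⟩

/-- Whatever the closure adds to `filledAt n` lies in `cover n`, whose area is at most a multiple of
(2/3)^n. -/
theorem volume_real_filled_le : volume.real filled ≤ √3 / 12 := by
  have key : ∀ n, volume.real filled ≤ √3 / 12 + (2 / 3) ^ n * volume.real unitTriangle := by
    intro n
    refine (measureReal_mono (filled_subset_union_cover n) (volume_ne_top_of_isBounded
      ((isCompact_filledAt n).union (isCompact_cover n)).isBounded)).trans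
      ((measureReal_union_le _ _).trans (add_le_add ((volume_real_filledAt_le n).trans ?_)
        (volume_real_biUnion_sim_le n _)))
    have : 0 ≤ √3 / 12 * (2 / 3 : ℝ) ^ n := by positivity
    linarith
  have hlim : Tendsto (fun n : ℕ => √3 / 12 + (2 / 3 : ℝ) ^ n * volume.real unitTriangle) atTop
      (𝓝 (√3 / 12 + 0 * volume.real unitTriangle)) :=
    ((tendsto_pow_atTop_nhds_zero_of_lt_one (by norm_num) (by norm_num)).mul_const _).const_add _
  rw [zero_mul, add_zero] at hlim
  exact ge_of_tendsto' hlim key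

/-! ### The triangles -/

/-- The directed sides of the unit triangle. -/
noncomputable def sides : List (ℂ × ℂ) := [(0, 1), (1, omega), (omega, 0)]

/-- `e` is one of the segments of the three polygonal curves on the sides of the unit triangle. -/
def IsEdge (n : ℕ) (e : ℂ × ℂ) : Prop := ∃ b ∈ sides, ∃ s ∈ segments n, e = simPair b s

theorem IsEdge.succ {n : ℕ} {e g d : ℂ × ℂ} (he : IsEdge n e) (hg : g ∈ generator)
    (h : d = simPair e g) : IsEdge (n + 1) d := by
  obtain ⟨b, hb, s, hs, rfl⟩ := he
  exact ⟨b, hb, _, mem_segments_succ.2 ⟨s, hs, g, hg, rfl⟩, by rw [h, simPair_simPair]⟩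

theorem normSq_side {b : ℂ × ℂ} (hb : b ∈ sides) : Complex.normSq (b.2 - b.1) = 1 := by
  simp only [sides, List.mem_cons, List.not_mem_nil, or_false] at hb
  rcases hb with rfl | rfl | rfl <;>
  simp only [normSq_eq_ht, ht_sub, Complex.sub_re, ht_omega, omega_re, ht_zero, ht_one,
    Complex.zero_re, Complex.one_re] <;> norm_num

theorem norm_side {b : ℂ × ℂ} (hb : b ∈ sides) : ‖b.2 - b.1‖ = 1 := by
  have := normSq_side hb
  rw [Complex.normSq_eq_norm_sq] at this
  exact (pow_eq_one_iff_of_nonneg (norm_nonneg _) two_ne_zero).1 this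

theorem side_ne {b : ℂ × ℂ} (hb : b ∈ sides) : b.1 ≠ b.2 := by
  intro h
  have := normSq_side hb
  simp [h] at this

/-- A counterclockwise equilateral triangle with sides on the three polygonal curves. -/
structure IsTile (n : ℕ) (t : ℂ × ℂ × ℂ) : Prop where
  equilateral : t.2.2 = t.1 + omega * (t.2.1 - t.1)
  edge₁ : IsEdge n (t.1, t.2.1)
  edge₂ : IsEdge n (t.2.1, t.2.2)
  edge₃ : IsEdge n (t.2.2, t.1)

/-- The twelve sides of the four new triangles are, with orientation, the four pieces of each of the
three old sides; the central triangle takes the three long pieces. -/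
theorem IsTile.replace {n : ℕ} {t u : ℂ × ℂ × ℂ} (ht : IsTile n t) (hu : u ∈ replaceTriangle t) :
    IsTile (n + 1) u := by
  obtain ⟨P, Q, R⟩ := t
  obtain ⟨h, h1, h2, h3⟩ := ht
  simp only at h h1 h2 h3
  have g1 : ((0, 1 / 3) : ℂ × ℂ) ∈ generator := by simp [generator]
  have g2 : ((1 / 3, apex) : ℂ × ℂ) ∈ generator := by simp [generator]
  have g3 : ((apex, 2 / 3) : ℂ × ℂ) ∈ generator := by simp [generator]
  have g4 : ((2 / 3, 1) : ℂ × ℂ) ∈ generator := by simp [generator]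
  have hω := omega_mul_omega
  simp only [replaceTriangle, List.mem_cons, List.not_mem_nil, or_false] at hu
  subst h
  rcases hu with rfl | rfl | rfl | rfl
  · refine ⟨?_, h1.succ g1 ?_, h3.succ g3 ?_, h3.succ g4 ?_⟩ <;>
    simp only [simPair, sim, apex, Prod.mk.injEq]
    · ring
    · constructor <;> ring
    · constructor
      · linear_combination (Q - P) / 3 * hω
      · ring
    · constructor <;> ring
  · refine ⟨?_, h1.succ g4 ?_, h2.succ g1 ?_, h1.succ g3 ?_⟩ <;>
    simp only [simPair, sim, apex, Prod.mk.injEq]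
    · ring
    · constructor <;> ring
    · constructor <;> ring
    · constructor <;> ring
  · refine ⟨?_, h2.succ g3 ?_, h2.succ g4 ?_, h3.succ g1 ?_⟩ <;>
    simp only [simPair, sim, apex, Prod.mk.injEq]
    · ring
    · constructor
      · linear_combination -(Q - P) / 3 * hω
      · ring
    · constructor <;> ring
    · constructor <;> ring
  · refine ⟨?_, h1.succ g2 ?_, h2.succ g2 ?_, h3.succ g2 ?_⟩ <;>
    simp only [simPair, sim, apex, Prod.mk.injEq]
    · linear_combination -(Q - P) / 3 * hω
    · constructor <;> ring
    · constructor
      · ring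
      · linear_combination -(Q - P) / 3 * hω
    · constructor
      · ring
      · linear_combination (Q - P) / 3 * hω

theorem mem_triangles_succ {n : ℕ} {u : ℂ × ℂ × ℂ} :
    u ∈ triangles (n + 1) ↔ ∃ t ∈ triangles n, u ∈ replaceTriangle t := by
  simp [triangles]

theorem isTile_of_mem {n : ℕ} {t : ℂ × ℂ × ℂ} (ht : t ∈ triangles n) : IsTile n t := by
  induction n generalizing t with
  | zero =>
    simp only [triangles, List.mem_singleton] at ht; subst ht
    refine ⟨by simp, ?_, ?_, ?_⟩ <;> refine ⟨_, ?_, (0, 1), by simp [segments],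
      (simPair_unit _).symm⟩ <;> simp [sides]
  | succ n ih =>
    obtain ⟨u, hu, h⟩ := mem_triangles_succ.1 ht
    exact (ih hu).replace h

theorem solidTriangle_eq_sim {P Q R : ℂ} (h : R = P + omega * (Q - P)) :
    solidTriangle (P, Q, R) = sim (P, Q) '' unitTriangle := by
  rw [unitTriangle, sim_image_solidTriangle, sim_zero, sim_one, h]
  simp only [sim]; rw [mul_comm]

theorem sim_core_eq {P Q R : ℂ} (h : R = P + omega * (Q - P)) :
    sim (P, Q) '' core = solidTriangle (P + (Q - P) / 3, Q + (R - Q) / 3, Q + (P - Q) / 3) := by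
  rw [core, sim_image_solidTriangle]
  have e1 : sim (P, Q) (1 / 3) = P + (Q - P) / 3 := by simp only [sim]; ring
  have e2 : sim (P, Q) apex = Q + (R - Q) / 3 := by simp only [sim, apex, h]; ring
  have e3 : sim (P, Q) (2 / 3) = Q + (P - Q) / 3 := by simp only [sim]; ring
  rw [e1, e2, e3]

theorem equilateral_rotate {P Q R : ℂ} (h : R = P + omega * (Q - P)) :
    P = Q + omega * (R - Q) := by
  subst h; linear_combination -(Q - P) * omega_mul_omega

/-- A triangle is covered by the triangles which replace it and by the triangles raised over its
sides. -/
theorem solidTriangle_subset {P Q R z : ℂ} (h : R = P + omega * (Q - P))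
    (hz : z ∈ solidTriangle (P, Q, R)) :
    (∃ u ∈ replaceTriangle (P, Q, R), z ∈ solidTriangle u) ∨ z ∈ sim (P, Q) '' core ∨
      z ∈ sim (Q, R) '' core ∨ z ∈ sim (R, P) '' core := by
  have h2 := equilateral_rotate h
  have h3 := equilateral_rotate h2
  rw [sim_core_eq h, sim_core_eq h2, sim_core_eq h3]
  clear h h2 h3
  simp only [replaceTriangle, List.mem_cons, List.not_mem_nil, or_false, exists_eq_or_imp,
    exists_eq_left]
  obtain ⟨a, b, c, ha, hb, hc, h, rfl⟩ := mem_solidTriangle.1 hz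
  have h' : (a : ℂ) + b + c = 1 := by exact_mod_cast h
  simp only [mem_solidTriangle]
  -- The corner triangles are where one barycentric coordinate is at least 2/3.
  by_cases h1 : 2 / 3 ≤ a
  · refine .inl (.inl ⟨3 * a - 2, 3 * b, 3 * c, by linarith, by linarith, by linarith, by linarith,
      ?_⟩)
    push_cast; linear_combination -2 * P * h'
  by_cases h2 : 2 / 3 ≤ b
  · refine .inl (.inr (.inl ⟨3 * a, 3 * b - 2, 3 * c, by linarith, by linarith, by linarith,
      by linarith, ?_⟩))
    push_cast; linear_combination -2 * Q * h'
  by_cases h3 : 2 / 3 ≤ c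
  · refine .inl (.inr (.inr (.inl ⟨3 * a, 3 * b, 3 * c - 2, by linarith, by linarith, by linarith,
      by linarith, ?_⟩)))
    push_cast; linear_combination -2 * R * h'
  push Not at h1 h2 h3
  -- Up to the factor 3 this is a barycentric coordinate with respect to the central triangle. If it
  -- is not positive, the point is on or beyond the side shared with the core over P → Q.
  by_cases k1 : 4 * c + a - 2 * b ≤ 0
  · refine .inr (.inl ⟨2 - 3 * b, 3 * c, 3 * b - 1 - 3 * c, by linarith, by linarith, by linarith,
      by ring, ?_⟩)
    push_cast; linear_combination P * h'
  by_cases k2 : 4 * a + b - 2 * c ≤ 0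
  · refine .inr (.inr (.inl ⟨2 - 3 * c, 3 * a, 3 * c - 1 - 3 * a, by linarith, by linarith,
      by linarith, by ring, ?_⟩))
    push_cast; linear_combination Q * h'
  by_cases k3 : 4 * b + c - 2 * a ≤ 0
  · refine .inr (.inr (.inr ⟨2 - 3 * a, 3 * b, 3 * a - 1 - 3 * b, by linarith, by linarith,
      by linarith, by ring, ?_⟩))
    push_cast; linear_combination R * h'
  push Not at k1 k2 k3
  refine .inl (.inr (.inr (.inr ⟨(4 * a + b - 2 * c) / 3, (4 * b + c - 2 * a) / 3,
    (4 * c + a - 2 * b) / 3, by linarith, by linarith, by linarith, by linarith, ?_⟩)))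
  push_cast; ring

theorem IsEdge.sim_core_subset {n : ℕ} {e : ℂ × ℂ} (he : IsEdge n e) :
    sim e '' core ⊆ ⋃ b ∈ sides, sim b '' filledAt (n + 1) := by
  obtain ⟨b, hb, s, hs, rfl⟩ := he
  rintro _ ⟨z, hz, rfl⟩
  rw [sim_simPair]
  exact Set.mem_biUnion hb ⟨_, mem_filledAt.2 ⟨n, n.lt_succ_self, s, hs, z, hz, rfl⟩, rfl⟩

/-- After `n` iterations the unit triangle is covered by the triangles and the regions between its
sides and the curves. -/
theorem unitTriangle_subset (n : ℕ) : unitTriangle ⊆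
    (⋃ b ∈ sides, sim b '' filledAt n) ∪ ⋃ t ∈ triangles n, solidTriangle t := by
  induction n with
  | zero => exact fun z hz => .inr (by
    simp only [triangles, List.mem_singleton, Set.iUnion_iUnion_eq_left]; exact hz)
  | succ n ih =>
    intro z hz
    rcases ih hz with h | h
    · left
      exact Set.biUnion_mono subset_rfl (fun b _ => Set.image_mono (filledAt_mono n.le_succ)) h
    · simp only [Set.mem_iUnion, exists_prop] at h
      obtain ⟨⟨P, Q, R⟩, ht, hz⟩ := h
      have hT := isTile_of_mem ht
      rcases solidTriangle_subset hT.equilateral hz with ⟨u, hu, hz⟩ | h | h | h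
      · right
        simp only [Set.mem_iUnion, exists_prop]
        exact ⟨u, mem_triangles_succ.2 ⟨_, ht, hu⟩, hz⟩
      · exact .inl (hT.edge₁.sim_core_subset h)
      · exact .inl (hT.edge₂.sim_core_subset h)
      · exact .inl (hT.edge₃.sim_core_subset h)

/-! ### The three copies of the filled curve tile the unit triangle -/

theorem sim_side_subset {b : ℂ × ℂ} (hb : b ∈ sides) : sim b '' filled ⊆ unitTriangle := by
  have hω : omega ∈ unitTriangle := subset_convexHull ℝ _ (by simp)
  have h : sim b '' unitTriangle ⊆ unitTriangle := by
    rw [unitTriangle, sim_image_solidTriangle]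
    refine convexHull_min ?_ convex_unitTriangle
    have hmem : sim b omega ∈ unitTriangle ∧ b.1 ∈ unitTriangle ∧ b.2 ∈ unitTriangle := by
      simp only [sides, List.mem_cons, List.not_mem_nil, or_false] at hb
      rcases hb with rfl | rfl | rfl
      · exact ⟨by rwa [sim_unit], zero_mem_unitTriangle, one_mem_unitTriangle⟩
      · refine ⟨?_, one_mem_unitTriangle, hω⟩
        have : sim (1, omega) omega = 0 := by
          simp only [sim]; linear_combination omega_mul_omega
        rw [this]; exact zero_mem_unitTriangle
      · refine ⟨?_, hω, zero_mem_unitTriangle⟩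
        have : sim (omega, 0) omega = 1 := by
          simp only [sim]; linear_combination -omega_mul_omega
        rw [this]; exact one_mem_unitTriangle
    rintro w (rfl | rfl | rfl)
    · rw [sim_zero]; exact hmem.2.1
    · rw [sim_one]; exact hmem.2.2
    · exact hmem.1
  exact (Set.image_mono filled_subset_unitTriangle).trans h

theorem isCompact_filled : IsCompact filled :=
  isCompact_unitTriangle.of_isClosed_subset isClosed_filled filled_subset_unitTriangle

theorem isCompact_sim_filled (b : ℂ × ℂ) : IsCompact (sim b '' filled) :=
  isCompact_filled.image (continuous_sim b)

/-- A point not yet covered at level n lies in a tile of side at most (2/3)^n, which has a vertex on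
one of the three curves; the copies of `filled` are closed. -/
theorem unitTriangle_eq_biUnion : unitTriangle = ⋃ b ∈ sides, sim b '' filled := by
  refine subset_antisymm (fun p hp => ?_) (Set.iUnion₂_subset fun b hb => sim_side_subset hb)
  have hcl : IsClosed (⋃ b ∈ sides, sim b '' filled) :=
    ((List.finite_toSet sides).isCompact_biUnion fun b _ => isCompact_sim_filled b).isClosed
  rw [← hcl.closure_eq]
  refine mem_closure_of_forall_pow fun n => ?_
  rcases unitTriangle_subset n hp with h | h
  · refine ⟨p, Set.biUnion_mono subset_rfl (fun b _ => Set.image_mono (filledAt_subset_filled n)) h,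
      by rw [dist_self]; positivity⟩
  · simp only [Set.mem_iUnion, exists_prop] at h
    obtain ⟨⟨P, Q, R⟩, ht, hz⟩ := h
    have hT := isTile_of_mem ht
    rw [solidTriangle_eq_sim hT.equilateral] at hz
    obtain ⟨z, hz, rfl⟩ := hz
    obtain ⟨b, hb, s, hs, he⟩ := hT.edge₁
    simp only at he
    rw [he, sim_simPair]
    refine ⟨sim b (sim s 0), Set.mem_biUnion hb ⟨_, ?_, rfl⟩, ?_⟩
    · rw [sim_zero]; exact curve_subset_filled (endpoint_mem_curve hs).1
    · rw [dist_sim, norm_side hb, one_mul]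
      exact sim_mem_of_segment_norm hs hz zero_mem_unitTriangle

theorem unitTriangle_eq_union : unitTriangle =
    filled ∪ sim (1, omega) '' filled ∪ sim (omega, 0) '' filled := by
  have h0 : sim (0, 1) '' filled = filled := by
    rw [show sim (0, 1) = id from funext sim_unit, Set.image_id]
  rw [unitTriangle_eq_biUnion]
  simp only [sides, List.mem_cons, List.not_mem_nil, or_false, Set.iUnion_iUnion_eq_or_left,
    Set.iUnion_iUnion_eq_left, h0, Set.union_assoc]

theorem volume_real_sim_side {b : ℂ × ℂ} (hb : b ∈ sides) (X : Set ℂ) :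
    volume.real (sim b '' X) = volume.real X := by
  rw [volume_real_sim_image, normSq_side hb, one_mul]

theorem mem_sides₂ : ((1, omega) : ℂ × ℂ) ∈ sides := by simp [sides]
theorem mem_sides₃ : ((omega, 0) : ℂ × ℂ) ∈ sides := by simp [sides]

/-- Three copies, each of area at most √3/12, cover a triangle of area √3/4. -/
theorem volume_real_filled : volume.real filled = √3 / 12 := by
  refine volume_real_filled_le.antisymm ?_
  have h : volume.real unitTriangle ≤ _ := unitTriangle_eq_union ▸
    (measureReal_union_le _ _).trans (add_le_add_left (measureReal_union_le _ _) _)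
  rw [volume_real_unitTriangle, volume_real_sim_side mem_sides₂,
    volume_real_sim_side mem_sides₃] at h
  linarith

/-- If the union of three sets has the total measure of the sets then any two of them intersect in a
null set. -/
theorem volume_inter_eq_zero {A B C : Set ℂ} (hA : IsCompact A) (hB : IsCompact B)
    (h : volume.real A + volume.real B + volume.real C ≤ volume.real (A ∪ B ∪ C)) :
    volume (A ∩ B) = 0 := by
  have h1 := measureReal_union_add_inter (μ := volume) (s := A) hB.isClosed.measurableSet
    (volume_ne_top_of_isBounded hA.isBounded) (volume_ne_top_of_isBounded hB.isBounded)
  have h2 := measureReal_union_le (μ := volume) (A ∪ B) C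
  have h3 : volume.real (A ∩ B) = 0 := le_antisymm (by linarith) measureReal_nonneg
  rwa [measureReal_eq_zero_iff
    (volume_ne_top_of_isBounded (hA.isBounded.subset Set.inter_subset_left))] at h3

theorem volume_filled_inter₂ : volume (filled ∩ sim (1, omega) '' filled) = 0 := by
  refine volume_inter_eq_zero (C := sim (omega, 0) '' filled) isCompact_filled
    (isCompact_sim_filled _) ?_
  rw [← unitTriangle_eq_union, volume_real_sim_side mem_sides₂, volume_real_sim_side mem_sides₃,
    volume_real_filled, volume_real_unitTriangle]
  linarith

theorem volume_filled_inter₃ : volume (filled ∩ sim (omega, 0) '' filled) = 0 := by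
  refine volume_inter_eq_zero (C := sim (1, omega) '' filled) isCompact_filled
    (isCompact_sim_filled _) ?_
  rw [Set.union_right_comm, ← unitTriangle_eq_union, volume_real_sim_side mem_sides₂,
    volume_real_sim_side mem_sides₃, volume_real_filled, volume_real_unitTriangle]
  linarith

theorem volume_sim_inter : volume (sim (1, omega) '' filled ∩ sim (omega, 0) '' filled) = 0 := by
  refine volume_inter_eq_zero (C := filled) (isCompact_sim_filled _) (isCompact_sim_filled _) ?_
  rw [Set.union_comm, ← Set.union_assoc, ← unitTriangle_eq_union, volume_real_sim_side mem_sides₂,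
    volume_real_sim_side mem_sides₃, volume_real_filled, volume_real_unitTriangle]
  linarith

/-! ### Points outside a copy of the filled curve are not enclosed by it -/

/-- `p` can be joined to infinity outside `X`. -/
def Escapes (X : Set ℂ) (p : ℂ) : Prop :=
  ∃ A, IsPreconnected A ∧ p ∈ A ∧ A ⊆ Xᶜ ∧ ¬ Bornology.IsBounded A

theorem Escapes.of_isPreconnected {X B : Set ℂ} {p q : ℂ} (h : Escapes X q) (hB : IsPreconnected B)
    (hBX : B ⊆ Xᶜ) (hp : p ∈ B) (hq : q ∈ B) : Escapes X p := by
  obtain ⟨A, hA, hqA, hAX, hu⟩ := h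
  exact ⟨A ∪ B, hA.union q hqA hq hB, .inr hp, Set.union_subset hAX hBX,
    fun hb => hu (hb.subset Set.subset_union_left)⟩

/-- A small ball around p avoids the closed set X and reaches a point of Y. -/
theorem escapes_of_mem_closure {X Y : Set ℂ} {p : ℂ} (hX : IsClosed X) (hp : p ∉ X)
    (hc : p ∈ closure Y) (hY : ∀ q ∈ Y, Escapes X q) : Escapes X p := by
  obtain ⟨ε, hε, hball⟩ := Metric.isOpen_iff.1 hX.isOpen_compl p hp
  obtain ⟨q, hq, hqY⟩ := mem_closure_iff_nhds.1 hc _ (Metric.ball_mem_nhds p hε)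
  exact (hY q hqY).of_isPreconnected (convex_ball p ε).isPreconnected hball
    (Metric.mem_ball_self hε) hq

/-- Adding one closure point keeps Y connected, so an open triangle escapes as soon as one of its
boundary points does. -/
theorem Escapes.of_mem_closure {X Y : Set ℂ} {p q : ℂ} (h : Escapes X p) (hc : p ∈ closure Y)
    (hY : IsPreconnected Y) (hYX : Y ⊆ Xᶜ) (hq : q ∈ Y) : Escapes X q := by
  have hpX : p ∈ Xᶜ := by obtain ⟨A, -, hp, hA, -⟩ := h; exact hA hp
  exact h.of_isPreconnected
    (hY.subset_closure (Set.subset_insert p Y) (Set.insert_subset hc subset_closure))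
    (Set.insert_subset hpX hYX) (.inr hq) (.inl rfl)

theorem not_isBounded_of_ray {A : Set ℂ} {u : ℂ} (hu : ‖u‖ = 1) (h : ∀ t : ℝ, 1 < t → t * u ∈ A) :
    ¬ Bornology.IsBounded A := by
  intro hb
  obtain ⟨R, hR⟩ := hb.exists_norm_le
  have := hR _ (h (|R| + 2) (by linarith [abs_nonneg R]))
  rw [norm_mul, hu, mul_one, Complex.norm_real, Real.norm_eq_abs,
    abs_of_nonneg (by positivity)] at this
  linarith [le_abs_self R]

/-- The point lies in an open half plane beyond one of the three sides, which is convex, unbounded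
and free of X. -/
theorem escapes_of_notMem_unitTriangle {X : Set ℂ} (hX : X ⊆ unitTriangle) {p : ℂ}
    (hp : p ∉ unitTriangle) : Escapes X p := by
  have hlin : ∀ c : ℝ, IsLinearMap ℝ fun z : ℂ => ht z + c * z.re := fun c =>
    ⟨fun z w => by simp only [ht_add, Complex.add_re]; ring, fun a z => by
      rw [Complex.real_smul, ht_ofReal_mul, Complex.re_ofReal_mul, smul_eq_mul]; ring⟩
  rw [mem_unitTriangle] at hp
  by_cases h1 : 0 ≤ ht p
  swap
  · refine ⟨{z | ht z + 0 * z.re < 0}, (convex_halfSpace_lt (hlin 0) 0).isPreconnected, ?_,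
      fun z hz hzX => ?_, not_isBounded_of_ray (u := -Complex.I) (by simp) fun t ht' => ?_⟩
    · simpa using h1
    · have := (mem_unitTriangle.1 (hX hzX)).1
      simp only [Set.mem_ofPred_eq] at hz; linarith
    · have hI : ht Complex.I = √3 := by simp [ht]
      have : 0 < t * √3 := by positivity
      rw [Set.mem_ofPred_eq, ht_ofReal_mul, ht_neg, hI]
      linarith
  by_cases h2 : ht p ≤ 3 * p.re
  swap
  · refine ⟨{z | 0 < ht z + (-3) * z.re}, (convex_halfSpace_gt (hlin (-3)) 0).isPreconnected, ?_,
      fun z hz hzX => ?_, not_isBounded_of_ray (u := -1) (by simp) fun t ht' => ?_⟩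
    · simp only [Set.mem_ofPred_eq]; linarith
    · have := (mem_unitTriangle.1 (hX hzX)).2.1
      simp only [Set.mem_ofPred_eq] at hz; linarith
    · simp only [Set.mem_ofPred_eq, ht_ofReal_mul, ht_neg, ht_one, Complex.re_ofReal_mul,
        Complex.neg_re, Complex.one_re]
      linarith
  have h3 : 3 - 3 * p.re < ht p := by by_contra! h; exact hp ⟨h1, h2, h⟩
  refine ⟨{z | 3 < ht z + 3 * z.re}, (convex_halfSpace_gt (hlin 3) 3).isPreconnected, ?_,
    fun z hz hzX => ?_, not_isBounded_of_ray (u := 1) (by simp) fun t ht' => ?_⟩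
  · simp only [Set.mem_ofPred_eq]; linarith
  · have := (mem_unitTriangle.1 (hX hzX)).2.2
    simp only [Set.mem_ofPred_eq] at hz; linarith
  · simp only [Set.mem_ofPred_eq, ht_ofReal_mul, ht_one, Complex.re_ofReal_mul, Complex.one_re]
    linarith

theorem isPreconnected_openCore : IsPreconnected openCore := by
  have : Convex ℝ openCore := by
    intro z hz w hw a b ha hb hab
    rcases hb.eq_or_lt with rfl | hb
    · obtain rfl : a = 1 := by linarith
      simpa using hz
    · simpa only [Complex.real_smul] using
        combination_mem_openCore (openCore_subset_core hz) hw ha hb hab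
  exact this.isPreconnected

/-- The union of the interiors of the triangles which the iterations raise. -/
def openFilled : Set ℂ := ⋃ n, ⋃ s ∈ segments n, sim s '' openCore

theorem mem_openFilled {z : ℂ} :
    z ∈ openFilled ↔ ∃ n, ∃ s ∈ segments n, z ∈ sim s '' openCore := by
  simp only [openFilled, Set.mem_iUnion, exists_prop]

theorem isOpen_sim_openCore {n : ℕ} {s : ℂ × ℂ} (hs : s ∈ segments n) :
    IsOpen (sim s '' openCore) :=
  (simHomeomorph (ne_of_mem_segments hs)).isOpenMap _ isOpen_openCore

theorem isOpen_openFilled : IsOpen openFilled :=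
  isOpen_iUnion fun _ => isOpen_biUnion fun _ hs => isOpen_sim_openCore hs

theorem sim_openCore_subset_filled {n : ℕ} {s : ℂ × ℂ} (hs : s ∈ segments n) :
    sim s '' openCore ⊆ filled :=
  (Set.image_mono openCore_subset_core).trans (sim_core_subset_filled hs)

theorem openFilled_subset : openFilled ⊆ filled :=
  Set.iUnion_subset fun _ => Set.iUnion₂_subset fun _ hs => sim_openCore_subset_filled hs

theorem sim_mem_closure {s : ℂ × ℂ} {z : ℂ} (hz : z ∈ core) :
    sim s z ∈ closure (sim s '' openCore) :=
  image_closure_subset_closure_image (continuous_sim s) ⟨z, core_subset_closure_openCore hz, rfl⟩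

theorem filled_subset_closure : filled ⊆ closure openFilled := by
  refine closure_minimal (Set.iUnion_subset fun n z hz => ?_) isClosed_closure
  obtain ⟨k, -, s, hs, w, hw, rfl⟩ := mem_filledAt.1 hz
  exact closure_mono (fun q hq => mem_openFilled.2 ⟨k, s, hs, hq⟩) (sim_mem_closure hw)

theorem half_mem_core : ((1 / 2 : ℝ) : ℂ) ∈ core := mem_base_core (by norm_num) (by norm_num)

theorem sim_openCore_subset_compl {X : Set ℂ}
    (hsep : ∀ p, filled ∪ lowerHalf ∈ 𝓝 p → p ∉ X) {n : ℕ} {s : ℂ × ℂ} (hs : s ∈ segments n) :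
    sim s '' openCore ⊆ Xᶜ := fun q hq => hsep q (mem_of_superset
  ((isOpen_sim_openCore hs).mem_nhds hq)
  ((sim_openCore_subset_filled hs).trans Set.subset_union_left))

/-- Descent through the levels: a point of a slanted piece borders the triangle raised over the
parent segment, and a point of an outer piece already lies on the parent. At level 0 the point
borders the outside below the base. -/
theorem escapes_segment {X : Set ℂ} (hX : IsClosed X) (hXΔ : X ⊆ unitTriangle)
    (hsep : ∀ p, filled ∪ lowerHalf ∈ 𝓝 p → p ∉ X) {n : ℕ} {s : ℂ × ℂ} (hs : s ∈ segments n)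
    {x : ℝ} (h0 : 0 < x) (h1 : x < 1) (hl : LeftNhd filled s x) : Escapes X (sim s x) := by
  have hnot := hsep _ (mem_nhds_of_leftNhd hs h0 h1 hl)
  induction n generalizing s x with
  | zero =>
    simp only [segments, List.mem_singleton] at hs; subst hs
    rw [sim_unit] at hnot ⊢
    refine escapes_of_mem_closure hX hnot (Y := unitTriangleᶜ) ?_
      fun q hq => escapes_of_notMem_unitTriangle hXΔ hq
    rw [Metric.mem_closure_iff]
    intro ε hε
    refine ⟨x - (ε / 2 : ℝ) * Complex.I, fun h => ?_, ?_⟩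
    · have := ht_nonneg_iff.1 (mem_unitTriangle.1 h).1
      simp at this; linarith
    · rw [dist_eq_norm, sub_sub_cancel, norm_mul, Complex.norm_real, Complex.norm_I,
        Real.norm_eq_abs, abs_of_nonneg (by positivity)]
      linarith
  | succ n ih =>
    obtain ⟨r, hr, g, hg, rfl⟩ := mem_segments_succ.1 hs
    -- The open triangle over r leaves through the midpoint of its base, which lies on r and escapes
    -- by induction.
    have hcore : ∀ q ∈ sim r '' openCore, Escapes X q := by
      have hl' : LeftNhd filled r (1 / 2) :=
        (leftNhd_core (by norm_num) (by norm_num)).mono (sim_core_subset_filled hr)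
      intro q hq
      exact (ih hr (by norm_num) (by norm_num) hl'
        (hsep _ (mem_nhds_of_leftNhd hr (by norm_num) (by norm_num) hl'))).of_mem_closure
        (sim_mem_closure half_mem_core)
        (isPreconnected_openCore.image _ (continuous_sim r).continuousOn)
        (sim_openCore_subset_compl hsep hr) hq
    have hclos : sim g x ∈ core → Escapes X (sim (simPair r g) x) := fun h =>
      escapes_of_mem_closure hX hnot (by rw [sim_simPair]; exact sim_mem_closure h) hcore
    simp only [generator, List.mem_cons, List.not_mem_nil, or_false] at hg
    rcases hg with rfl | rfl | rfl | rfl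
    · have e : sim (simPair r (0, 1 / 3)) x = sim r ((x / 3 : ℝ) : ℂ) := by
        rw [sim_first]; push_cast; rfl
      have hl' : LeftNhd filled r (x / 3) := leftNhd_first (by rwa [mul_div_cancel₀ _ three_ne_zero])
      rw [e] at hnot ⊢
      exact ih hr (by linarith) (by linarith) hl' hnot
    · refine hclos (sim_second_mem_core.2 ?_)
      rw [ht_ofReal, Complex.ofReal_re]
      exact ⟨le_rfl, by linarith, by linarith⟩
    · refine hclos (sim_third_mem_core.2 ?_)
      rw [ht_ofReal, Complex.ofReal_re]
      exact ⟨le_rfl, by linarith, by linarith⟩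
    · have e : sim (simPair r (2 / 3, 1)) x = sim r (((2 + x) / 3 : ℝ) : ℂ) := by
        rw [sim_last]; push_cast; rfl
      have hl' : LeftNhd filled r ((2 + x) / 3) := leftNhd_last (by
        rwa [mul_div_cancel₀ _ three_ne_zero, add_sub_cancel_left])
      rw [e] at hnot ⊢
      exact ih hr (by linarith) (by linarith) hl' hnot

theorem escapes_of_mem_filled {X : Set ℂ} (hX : IsClosed X) (hXΔ : X ⊆ unitTriangle)
    (hsep : ∀ p, filled ∪ lowerHalf ∈ 𝓝 p → p ∉ X) {p : ℂ} (hp : p ∈ filled) (hpX : p ∉ X) :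
    Escapes X p := by
  refine escapes_of_mem_closure hX hpX (filled_subset_closure hp) fun q hq => ?_
  obtain ⟨n, s, hs, hq⟩ := mem_openFilled.1 hq
  exact (escapes_segment hX hXΔ hsep hs (x := 1 / 2) (by norm_num) (by norm_num)
    ((leftNhd_core (by norm_num) (by norm_num)).mono (sim_core_subset_filled hs))).of_mem_closure
    (sim_mem_closure half_mem_core)
    (isPreconnected_openCore.image _ (continuous_sim s).continuousOn)
    (sim_openCore_subset_compl hsep hs) hq

/-- Otherwise the open triangles of the copy would meet the interior of `filled ∪ lowerHalf` in a
nonempty open set. The copy avoids `lowerHalf`, so this set of positive area would lie in the null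
overlap. -/
theorem notMem_of_mem_nhds {b : ℂ × ℂ} (hb : b ∈ sides)
    (h0 : volume (filled ∩ sim b '' filled) = 0) (p : ℂ) (hp : filled ∪ lowerHalf ∈ 𝓝 p) :
    p ∉ sim b '' filled := by
  intro hpb
  have hc : p ∈ closure (sim b '' openFilled) := by
    obtain ⟨z, hz, rfl⟩ := hpb
    exact image_closure_subset_closure_image (continuous_sim b) ⟨z, filled_subset_closure hz, rfl⟩
  have ho : IsOpen (interior (filled ∪ lowerHalf) ∩ sim b '' openFilled) :=
    isOpen_interior.inter ((simHomeomorph (side_ne hb)).isOpenMap _ isOpen_openFilled)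
  have hne := mem_closure_iff.1 hc _ isOpen_interior (mem_interior_iff_mem_nhds.2 hp)
  refine (ho.measure_pos volume hne).ne' (measure_mono_null ?_ h0)
  rintro q ⟨hq1, hq2⟩
  have hq3 : q ∈ sim b '' filled := Set.image_mono openFilled_subset hq2
  refine ⟨(interior_subset hq1).resolve_right fun h => ?_, hq3⟩
  exact absurd (mem_unitTriangle.1 (sim_side_subset hb hq3)).1 (not_le.2 h)

theorem Escapes.image_sim {X : Set ℂ} {q : ℂ} {b : ℂ × ℂ} (hb : b ∈ sides) (h : Escapes X q) :
    Escapes (sim b '' X) (sim b q) := by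
  have hi : Isometry (sim b) := Isometry.of_dist_eq fun z w => by
    rw [dist_sim, norm_side hb, one_mul]
  obtain ⟨A, hA, hq, hAX, hu⟩ := h
  refine ⟨sim b '' A, hA.image _ (continuous_sim b).continuousOn, ⟨q, hq, rfl⟩, ?_, fun hbd => hu ?_⟩
  · rintro _ ⟨z, hz, rfl⟩ ⟨w, hw, e⟩
    exact hAX hz (hi.injective e ▸ hw)
  · have := hi.antilipschitz.isBounded_preimage hbd
    rwa [Set.preimage_image_eq _ hi.injective] at this

theorem sim_sim_two (z : ℂ) : sim (1, omega) (sim (omega, 0) z) = z := by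
  simp only [sim]; linear_combination (1 - z) * omega_mul_omega

theorem sim_sim_three (z : ℂ) : sim (omega, 0) (sim (1, omega) z) = z := by
  simp only [sim]; linear_combination -z * omega_mul_omega

/-- If p lies in another copy, rotating that copy onto `filled` carries the obstacle `filled` to the
third copy, which meets `filled` in a null set. -/
theorem escapes_of_notMem_filled {p : ℂ} (hp : p ∉ filled) : Escapes filled p := by
  by_cases hΔ : p ∈ unitTriangle
  swap
  · exact escapes_of_notMem_unitTriangle filled_subset_unitTriangle hΔ
  rw [unitTriangle_eq_union] at hΔ
  rcases hΔ with (h | ⟨q, hq, rfl⟩) | ⟨q, hq, rfl⟩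
  · exact absurd h hp
  · have hqX : q ∉ sim (omega, 0) '' filled := by
      rintro ⟨w, hw, rfl⟩; exact hp (by rwa [sim_sim_two])
    have := (escapes_of_mem_filled (isCompact_sim_filled _).isClosed (sim_side_subset mem_sides₃)
      (notMem_of_mem_nhds mem_sides₃ volume_filled_inter₃) hq hqX).image_sim mem_sides₂
    rwa [Set.image_image, Set.image_congr fun z _ => sim_sim_two z, Set.image_id'] at this
  · have hqX : q ∉ sim (1, omega) '' filled := by
      rintro ⟨w, hw, rfl⟩; exact hp (by rwa [sim_sim_three])
    have := (escapes_of_mem_filled (isCompact_sim_filled _).isClosed (sim_side_subset mem_sides₂)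
      (notMem_of_mem_nhds mem_sides₂ volume_filled_inter₂) hq hqX).image_sim mem_sides₃
    rwa [Set.image_image, Set.image_congr fun z _ => sim_sim_three z, Set.image_id'] at this

theorem waveRegion_eq_filled : waveRegion = filled := by
  refine subset_antisymm ?_ filled_subset_waveRegion
  rintro p (h | ⟨-, hbd⟩)
  · exact curve_union_segment_subset_filled h
  · by_contra hp
    obtain ⟨A, hA, hpA, hAX, hu⟩ := escapes_of_notMem_filled hp
    exact hu (hbd.subset (hA.subset_connectedComponentIn hpA
      (hAX.trans (Set.compl_subset_compl.2 curve_union_segment_subset_filled))))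

theorem waveRegionOn_eq (a b : ℂ) : waveRegionOn a b = sim (a, b) '' filled := by
  rw [waveRegionOn, waveRegion_eq_filled]; rfl

/-! ### The areas after finitely many iterations -/

/-- Three corners give 1/9 each; the central side is (1 + `omega`)/3 times the old one, with squared
norm 1/3. -/
theorem sum_normSq_triangles (n : ℕ) :
    ((triangles n).map fun t => Complex.normSq (t.2.1 - t.1)).sum = (2 / 3) ^ n := by
  induction n with
  | zero => simp [triangles]
  | succ n ih =>
    rw [triangles, sum_map_flatMap _ _ _ (2 / 3), ih]
    · ring
    rintro ⟨P, Q, R⟩ ht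
    have h := (isTile_of_mem ht).equilateral
    simp only at h
    have e1 : P + (Q - P) / 3 - P = ((1 / 3 : ℝ) : ℂ) * (Q - P) := by push_cast; ring
    have e2 : Q - (Q + (P - Q) / 3) = ((1 / 3 : ℝ) : ℂ) * (Q - P) := by push_cast; ring
    have e3 : R + (Q - R) / 3 - (R + (P - R) / 3) = ((1 / 3 : ℝ) : ℂ) * (Q - P) := by
      push_cast; ring
    have e4 : Q + (R - Q) / 3 - (P + (Q - P) / 3) = ((1 / 3 : ℝ) : ℂ) * ((1 + omega) * (Q - P)) := by
      rw [h]; push_cast; ring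
    have e5 : Complex.normSq (1 + omega) = 3 := by
      rw [normSq_eq_ht, ht_add, ht_omega, ht_one, Complex.add_re, omega_re, Complex.one_re]
      norm_num
    simp only [replaceTriangle, List.map_cons, List.map_nil, List.sum_cons, List.sum_nil,
      e1, e2, e3, e4, Complex.normSq_mul, Complex.normSq_ofReal, e5]
    ring

theorem triangleArea_le (n : ℕ) : triangleArea n ≤ √3 / 4 * (2 / 3) ^ n := by
  refine (volume_real_biUnion_le _ _).trans_eq ?_
  have : ∀ t ∈ triangles n, volume.real (solidTriangle t) =
      √3 / 4 * Complex.normSq (t.2.1 - t.1) := by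
    rintro ⟨P, Q, R⟩ ht
    rw [solidTriangle_eq_sim (isTile_of_mem ht).equilateral, volume_real_sim_image,
      volume_real_unitTriangle, mul_comm]
  rw [List.map_congr_left this, List.sum_map_mul_left, sum_normSq_triangles]

theorem unitTriangle_area_le (n : ℕ) :
    √3 / 4 ≤ 3 * volume.real (filledAt n) + triangleArea n := by
  have hb : ∀ b ∈ sides, IsCompact (sim b '' filledAt n) := fun b _ =>
    (isCompact_filledAt n).image (continuous_sim b)
  have hfin : volume ((⋃ b ∈ sides, sim b '' filledAt n) ∪
      ⋃ t ∈ triangles n, solidTriangle t) ≠ ⊤ :=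
    volume_ne_top_of_isBounded (((List.finite_toSet sides).isCompact_biUnion hb).union
      ((List.finite_toSet (triangles n)).isCompact_biUnion
        fun t _ => isCompact_solidTriangle t)).isBounded
  have h := (measureReal_mono (unitTriangle_subset n) hfin).trans (measureReal_union_le _ _)
  have h2 := volume_real_biUnion_le sides fun b => sim b '' filledAt n
  rw [List.map_congr_left fun b hb => volume_real_sim_side hb (filledAt n)] at h2
  rw [volume_real_unitTriangle] at h
  simp only [sides, List.map_cons, List.map_nil, List.sum_cons, List.sum_nil] at h h2
  rw [triangleArea]
  linarith

/-- The two upper bounds add up to the lower bound √3/4, which forces equality in both. -/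
theorem volume_real_filledAt (n : ℕ) :
    volume.real (filledAt n) = √3 / 12 * (1 - (2 / 3) ^ n) := by
  have h1 := volume_real_filledAt_le n
  have h2 := triangleArea_le n
  have h3 := unitTriangle_area_le n
  linarith

theorem triangleArea_eq (n : ℕ) : triangleArea n = √3 / 4 * (2 / 3) ^ n := by
  have h1 := volume_real_filledAt_le n
  have h2 := triangleArea_le n
  have h3 := unitTriangle_area_le n
  linarith

/-! ### Winding numbers of the closed polygons -/

/-- The oriented angle under which a directed segment is seen from a point. -/
noncomputable def angleFrom (p : ℂ) (s : ℂ × ℂ) : ℝ := Complex.arg ((s.2 - p) / (s.1 - p))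

theorem angleFrom_sim {s : ℂ × ℂ} (hs : s.1 ≠ s.2) (z : ℂ) (e : ℂ × ℂ) :
    angleFrom (sim s z) (simPair s e) = angleFrom z e := by
  simp only [angleFrom, simPair, sim_sub]
  rw [mul_div_mul_left _ _ (sub_ne_zero.2 hs.symm)]

theorem exists_arg_add_arg_sub {u v : ℂ} (hu : u ≠ 0) (hv : v ≠ 0) :
    ∃ k : ℤ, Complex.arg u + Complex.arg v - Complex.arg (u * v) = 2 * Real.pi * k := by
  have h := Complex.arg_mul_coe_angle hu hv
  rw [← Real.Angle.coe_add] at h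
  exact Real.Angle.angle_eq_iff_two_pi_dvd_sub.1 h.symm

theorem arg_mem_of_im_pos {u : ℂ} (hu : 0 < u.im) : 0 < u.arg ∧ u.arg < Real.pi := by
  refine ⟨(Complex.arg_nonneg_iff.2 hu.le).lt_of_ne fun h => ?_,
    (Complex.arg_le_pi u).lt_of_ne fun h => ?_⟩
  · exact hu.ne' (Complex.arg_eq_zero_iff.1 h.symm).2
  · exact hu.ne' (Complex.arg_eq_pi_iff.1 h).2

theorem arg_mem_of_im_neg {u : ℂ} (hu : u.im < 0) : -Real.pi < u.arg ∧ u.arg < 0 :=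
  ⟨Complex.neg_pi_lt_arg u, Complex.arg_neg_iff.2 hu⟩

theorem ne_zero_of_im_ne {u : ℂ} (h : u.im ≠ 0) : u ≠ 0 := by
  rintro rfl; simp at h

/-- The defect is a multiple of 2π and here lies in (-3π, 0). -/
theorem arg_add_arg_of_neg_neg_pos {u v : ℂ} (hu : u.im < 0) (hv : v.im < 0)
    (huv : 0 < (u * v).im) :
    Complex.arg u + Complex.arg v - Complex.arg (u * v) = -(2 * Real.pi) := by
  obtain ⟨k, hk⟩ := exists_arg_add_arg_sub (ne_zero_of_im_ne hu.ne) (ne_zero_of_im_ne hv.ne)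
  have h1 := arg_mem_of_im_neg hu
  have h2 := arg_mem_of_im_neg hv
  have h3 := arg_mem_of_im_pos huv
  have k1 : (k : ℝ) < 0 := by by_contra! h; nlinarith [Real.pi_pos]
  have k2 : (-2 : ℝ) < k := by by_contra! h; nlinarith [Real.pi_pos]
  have : k = -1 := by
    have : k < 0 := by exact_mod_cast k1
    have : -2 < k := by exact_mod_cast k2
    omega
  rw [hk, this]; push_cast; ring

/-- In the six remaining sign patterns the defect lies strictly between -2π and 2π. -/
theorem arg_add_arg_of_ne {u v : ℂ} (hu : u.im ≠ 0) (hv : v.im ≠ 0) (huv : (u * v).im ≠ 0)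
    (h₁ : ¬ (u.im < 0 ∧ v.im < 0 ∧ 0 < (u * v).im))
    (h₂ : ¬ (0 < u.im ∧ 0 < v.im ∧ (u * v).im < 0)) :
    Complex.arg u + Complex.arg v - Complex.arg (u * v) = 0 := by
  obtain ⟨k, hk⟩ := exists_arg_add_arg_sub (ne_zero_of_im_ne hu) (ne_zero_of_im_ne hv)
  have key : -(2 * Real.pi) < Complex.arg u + Complex.arg v - Complex.arg (u * v) ∧
      Complex.arg u + Complex.arg v - Complex.arg (u * v) < 2 * Real.pi := by
    have sgn : ∀ w : ℂ, w.im ≠ 0 → (w.im < 0 ∧ -Real.pi < w.arg ∧ w.arg < 0) ∨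
        (0 < w.im ∧ 0 < w.arg ∧ w.arg < Real.pi) := fun w hw =>
      hw.lt_or_gt.imp (fun h => ⟨h, arg_mem_of_im_neg h⟩) fun h => ⟨h, arg_mem_of_im_pos h⟩
    rcases sgn u hu with ⟨a, a1, a2⟩ | ⟨a, a1, a2⟩ <;>
      rcases sgn v hv with ⟨b, b1, b2⟩ | ⟨b, b1, b2⟩ <;>
      rcases sgn _ huv with ⟨c, c1, c2⟩ | ⟨c, c1, c2⟩
    · constructor <;> linarith
    · exact absurd ⟨a, b, c⟩ h₁
    · constructor <;> linarith
    · constructor <;> linarith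
    · constructor <;> linarith
    · constructor <;> linarith
    · exact absurd ⟨a, b, c⟩ h₂
    · constructor <;> linarith
  rw [hk] at key ⊢
  have k1 : (k : ℝ) < 1 := by by_contra! h; nlinarith [Real.pi_pos]
  have k2 : (-1 : ℝ) < k := by by_contra! h; nlinarith [Real.pi_pos]
  have : k = 0 := by
    have : k < 1 := by exact_mod_cast k1
    have : -1 < k := by exact_mod_cast k2
    omega
  rw [this]; simp

/-- `√3` times the cross product of two vectors. -/
noncomputable def cross (a b : ℂ) : ℝ := a.re * ht b - ht a * b.re

theorem div_im_eq_cross (a b : ℂ) : (b / a).im = cross a b / √3 / Complex.normSq a := by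
  have h3 : √3 ≠ 0 := by positivity
  rw [Complex.div_im, cross, ht, ht]
  field_simp

theorem div_im_pos {a b : ℂ} (h : 0 < cross a b) : 0 < (b / a).im := by
  rw [div_im_eq_cross]
  have : a ≠ 0 := by rintro rfl; simp [cross, ht] at h
  have := Complex.normSq_pos.2 this
  positivity

theorem div_im_neg {a b : ℂ} (h : cross a b < 0) : (b / a).im < 0 := by
  rw [div_im_eq_cross]
  have : a ≠ 0 := by rintro rfl; simp [cross, ht] at h
  have := Complex.normSq_pos.2 this
  exact div_neg_of_neg_of_pos (div_neg_of_neg_of_pos h (by positivity)) this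

theorem left_ne_zero_of_cross {a b : ℂ} (h : cross a b ≠ 0) : b ≠ 0 := by
  rintro rfl; simp [cross, ht] at h

theorem div_im_neg_iff {a b : ℂ} (h : cross a b ≠ 0) : (b / a).im < 0 ↔ cross a b < 0 := by
  refine ⟨fun h' => ?_, div_im_neg⟩
  by_contra! hc
  exact lt_asymm h' (div_im_pos (hc.lt_of_ne h.symm))

theorem div_im_pos_iff {a b : ℂ} (h : cross a b ≠ 0) : 0 < (b / a).im ↔ 0 < cross a b := by
  refine ⟨fun h' => ?_, div_im_pos⟩
  by_contra! hc
  exact lt_asymm h' (div_im_neg (hc.lt_of_ne h))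

theorem div_im_ne {a b : ℂ} (h : cross a b ≠ 0) : (b / a).im ≠ 0 := by
  rcases h.lt_or_gt with h | h
  exacts [(div_im_neg h).ne, (div_im_pos h).ne']

theorem arg_div_add_of_neg_neg_pos {a b c : ℂ} (hab : cross a b < 0) (hbc : cross b c < 0)
    (hac : 0 < cross a c) :
    Complex.arg (b / a) + Complex.arg (c / b) - Complex.arg (c / a) = -(2 * Real.pi) := by
  have hb : b ≠ 0 := left_ne_zero_of_cross hab.ne
  have e : b / a * (c / b) = c / a := by field_simp
  have := arg_add_arg_of_neg_neg_pos (div_im_neg hab) (div_im_neg hbc) (e ▸ div_im_pos hac)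
  rwa [e] at this

theorem arg_div_add_of_ne {a b c : ℂ} (hab : cross a b ≠ 0) (hbc : cross b c ≠ 0)
    (hac : cross a c ≠ 0) (h₁ : ¬ (cross a b < 0 ∧ cross b c < 0 ∧ 0 < cross a c))
    (h₂ : ¬ (0 < cross a b ∧ 0 < cross b c ∧ cross a c < 0)) :
    Complex.arg (b / a) + Complex.arg (c / b) - Complex.arg (c / a) = 0 := by
  have hb : b ≠ 0 := left_ne_zero_of_cross hab
  have e : b / a * (c / b) = c / a := by field_simp
  have := arg_add_arg_of_ne (div_im_ne hab) (div_im_ne hbc) (e ▸ div_im_ne hac)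
    (by rwa [e, div_im_neg_iff hab, div_im_neg_iff hbc, div_im_pos_iff hac])
    (by rwa [e, div_im_pos_iff hab, div_im_pos_iff hbc, div_im_neg_iff hac])
  rwa [e] at this

theorem cross_ofReal_sub (x y : ℝ) (z : ℂ) : cross (x - z) (y - z) = (y - x) * ht z := by
  simp only [cross, ht_sub, ht_ofReal, Complex.sub_re, Complex.ofReal_re]; ring

/-- Real points are seen from a point off the real axis under angles that add up. -/
theorem arg_add_arg_ofReal {x y w : ℝ} (h1 : x < y) (h2 : y < w) {z : ℂ} (hz : ht z ≠ 0) :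
    Complex.arg ((y - z) / (x - z)) + Complex.arg ((w - z) / (y - z)) =
      Complex.arg ((w - z) / (x - z)) := by
  have c1 : 0 < y - x := by linarith
  have c2 : 0 < w - y := by linarith
  have c3 : 0 < w - x := by linarith
  refine sub_eq_zero.1 (arg_div_add_of_ne ?_ ?_ ?_ ?_ ?_) <;> simp only [cross_ofReal_sub]
  · exact mul_ne_zero c1.ne' hz
  · exact mul_ne_zero c2.ne' hz
  · exact mul_ne_zero c3.ne' hz
  · rintro ⟨h, -, h'⟩
    exact lt_asymm ((pos_iff_pos_of_mul_pos h').1 c3) (by nlinarith)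
  · rintro ⟨h, -, h'⟩
    exact lt_asymm ((pos_iff_pos_of_mul_pos h).1 c1) (by nlinarith)

/-- Replacing the unit segment changes the angle under which it is seen by `-2π` from the points in
the triangle raised over it, and does not change it from other points. -/
theorem sum_angleFrom_generator {z : ℂ} (h1 : ht z ≠ 0) (h2 : ht z ≠ z.re - 1 / 3)
    (h3 : ht z ≠ 3 * z.re - 2) [Decidable (z ∈ core)] :
    (generator.map (angleFrom z)).sum =
      angleFrom z (0, 1) + -(2 * Real.pi) * if z ∈ core then 1 else 0 := by
  -- Splitting the base angle at 1/3 and 2/3 reduces the claim to the detour through `apex`, that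
  -- is, to the winding of one triangle.
  have e1 := arg_add_arg_ofReal (x := 0) (y := 1 / 3) (w := 2 / 3) (by norm_num) (by norm_num) h1
  have e2 := arg_add_arg_ofReal (x := 0) (y := 2 / 3) (w := 1) (by norm_num) (by norm_num) h1
  have c1 : cross ((1 / 3 : ℝ) - z) (apex - z) = (ht z - (z.re - 1 / 3)) / 2 := by
    simp only [cross, ht_sub, ht_ofReal, ht_apex, Complex.sub_re, Complex.ofReal_re, apex_re]; ring
  have c2 : cross (apex - z) ((2 / 3 : ℝ) - z) = (3 * z.re - 2 - ht z) / 6 := by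
    simp only [cross, ht_sub, ht_ofReal, ht_apex, Complex.sub_re, Complex.ofReal_re, apex_re]; ring
  have c3 := cross_ofReal_sub (1 / 3) (2 / 3) z
  have e3 : Complex.arg ((apex - z) / ((1 / 3 : ℝ) - z)) +
      Complex.arg (((2 / 3 : ℝ) - z) / (apex - z)) -
      Complex.arg (((2 / 3 : ℝ) - z) / ((1 / 3 : ℝ) - z)) =
      -(2 * Real.pi) * if z ∈ core then 1 else 0 := by
    split_ifs with hz
    · obtain ⟨k1, k2, k3⟩ := mem_core.1 hz
      have k1' := k1.lt_of_ne h1.symm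
      have k2' := k2.lt_of_ne h2
      have k3' := k3.lt_of_ne h3.symm
      rw [mul_one]
      refine arg_div_add_of_neg_neg_pos ?_ ?_ ?_
      · rw [c1]; linarith
      · rw [c2]; linarith
      · rw [c3]; linarith
    · rw [mul_zero]
      refine arg_div_add_of_ne ?_ ?_ ?_ ?_ ?_
      · rw [c1]; exact div_ne_zero (sub_ne_zero.2 h2) two_ne_zero
      · rw [c2]; exact div_ne_zero (sub_ne_zero.2 h3.symm) (by norm_num)
      · rw [c3]; exact mul_ne_zero (by norm_num) h1
      · rw [c1, c2, c3]
        rintro ⟨k1, k2, k3⟩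
        exact hz (mem_core.2 ⟨by linarith, by linarith, by linarith⟩)
      · rw [c1, c2, c3]
        rintro ⟨k1, k2, k3⟩
        linarith
  push_cast at e1 e2 e3
  simp only [generator, List.map_cons, List.map_nil, List.sum_cons, List.sum_nil, angleFrom]
  linarith

/-- `p` does not lie on the line through any of the segments. -/
def Generic (p : ℂ) : Prop := ∀ n, ∀ s ∈ segments n, ht (simInv s p) ≠ 0

theorem volume_ht_eq_zero : volume {z : ℂ | ht z = 0} = 0 := by
  have h : {z : ℂ | ht z = 0} = (LinearMap.ker Complex.imLm : Submodule ℝ ℂ) := by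
    ext z; simp [ht]
  rw [h]
  refine Measure.addHaar_submodule volume _ fun htop => ?_
  have : Complex.I ∈ LinearMap.ker Complex.imLm := htop ▸ Submodule.mem_top
  simp at this

theorem ae_generic : ∀ᵐ p : ℂ, Generic p := by
  refine ae_all_iff.2 fun n => (ae_ball_iff (List.finite_toSet (segments n)).countable).2 ?_
  intro s hs
  replace hs : s ∈ segments n := hs
  have := volume_sim_image_eq_zero s volume_ht_eq_zero
  rw [image_sim (ne_of_mem_segments hs)] at this
  rw [ae_iff]
  simpa using this

theorem Generic.angle_step {p : ℂ} (hp : Generic p) {n : ℕ} {s : ℂ × ℂ} (hs : s ∈ segments n)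
    [Decidable (p ∈ sim s '' core)] :
    ((replaceSegment s).map (angleFrom p)).sum =
      angleFrom p s + -(2 * Real.pi) * if p ∈ sim s '' core then 1 else 0 := by
  classical
  have hne := ne_of_mem_segments hs
  obtain ⟨z, rfl⟩ : ∃ z, sim s z = p := ⟨_, sim_simInv hne p⟩
  have hinj : sim s z ∈ sim s '' core ↔ z ∈ core :=
    (simHomeomorph hne).injective.mem_set_image
  have h1 : ht z ≠ 0 := by simpa [simInv_sim hne] using hp n s hs
  have child : ∀ g ∈ generator, ∃ w, sim g w = z ∧ ht w ≠ 0 := by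
    intro g hg
    have hm : simPair s g ∈ segments (n + 1) := mem_segments_succ.2 ⟨s, hs, g, hg, rfl⟩
    have hw : sim g (simInv g z) = z := sim_simInv (generator_ne hg) z
    refine ⟨simInv g z, hw, ?_⟩
    have := hp _ _ hm
    rwa [← hw, ← sim_simPair, simInv_sim (ne_of_mem_segments hm)] at this
  have h2 : ht z ≠ z.re - 1 / 3 := by
    obtain ⟨w, rfl, hw⟩ := child (1 / 3, apex) (by simp [generator])
    intro h
    simp only [sim_second_eq, ht_add, ht_ofReal_mul, ht_omega_mul, re_omega_mul, Complex.add_re,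
      Complex.re_ofReal_mul, Complex.ofReal_re, ht_ofReal] at h
    exact hw (by linarith)
  have h3 : ht z ≠ 3 * z.re - 2 := by
    obtain ⟨w, rfl, hw⟩ := child (apex, 2 / 3) (by simp [generator])
    intro h
    simp only [sim_third_eq, ht_add, ht_sub, ht_ofReal_mul, ht_omega_mul, re_omega_mul,
      Complex.add_re, Complex.sub_re, Complex.re_ofReal_mul, Complex.ofReal_re, ht_ofReal,
      ht_omega, omega_re] at h
    exact hw (by linarith)
  have key := sum_angleFrom_generator h1 h2 h3
  rw [replaceSegment_eq, List.map_map]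
  have e : angleFrom (sim s z) ∘ simPair s = angleFrom z := funext fun g => angleFrom_sim hne z g
  have e' : angleFrom (sim s z) s = angleFrom z (0, 1) := by
    rw [← angleFrom_sim hne z (0, 1), simPair_unit]
  rw [e, e', key]
  simp only [hinj]

theorem sum_map_flatMap_add {α : Type*} (l : List α) (f : α → List α) (g h : α → ℝ)
    (H : ∀ a ∈ l, ((f a).map g).sum = g a + h a) :
    ((l.flatMap f).map g).sum = (l.map g).sum + (l.map h).sum := by
  induction l with
  | nil => simp
  | cons a l ih =>
    simp only [List.flatMap_cons, List.map_append, List.sum_append, List.map_cons, List.sum_cons]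
    rw [H a (by simp), ih fun b hb => H b (by simp [hb])]; ring

/-- The closed polygon winds around a point clockwise, as often as it lies in the triangles raised
so far. -/
theorem Generic.exists_winding {p : ℂ} (hp : Generic p) (n : ℕ) : ∃ N : ℕ,
    ((closedPolygon n).map (angleFrom p)).sum = -(2 * Real.pi) * N ∧
      (0 < N ↔ p ∈ filledAt n) := by
  classical
  induction n with
  | zero =>
    refine ⟨0, ?_, by simp [mem_filledAt]⟩
    have h0 : ht p ≠ 0 := by
      have := hp 0 (0, 1) (by simp [segments])
      simpa [simInv] using this
    have hcr : cross (0 - p) (1 - p) ≠ 0 := by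
      have := cross_ofReal_sub 0 1 p
      push_cast at this
      rw [this]; simpa using h0
    have him := div_im_ne hcr
    simp only [closedPolygon, segments, List.singleton_append, List.map_cons, List.map_nil,
      List.sum_cons, List.sum_nil, angleFrom]
    -- The edge and its reverse are seen under opposite angles, since p is off the real line and the
    -- argument is not π.
    rw [← inv_div (1 - p) (0 - p), Complex.arg_inv, if_neg]
    · simp
    · exact fun h => him (Complex.arg_eq_pi_iff.1 h).2
  | succ n ih =>
    obtain ⟨N, hN, hmem⟩ := ih
    -- N counts raised triangles with multiplicity. No disjointness is needed, because contributions
    -- of equal sign cannot cancel.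
    refine ⟨N + ((segments n).filter fun s => p ∈ sim s '' core).length, ?_, ?_⟩
    · have hstep := sum_map_flatMap_add (segments n) replaceSegment (angleFrom p)
        (fun s => -(2 * Real.pi) * if p ∈ sim s '' core then 1 else 0) fun s hs => hp.angle_step hs
      have hcount : ((segments n).map fun s => if p ∈ sim s '' core then (1 : ℝ) else 0).sum =
          ((segments n).filter fun s => p ∈ sim s '' core).length := by
        induction segments n with
        | nil => simp
        | cons a l ih =>
          by_cases h : p ∈ sim a '' core <;> simp only [List.map_cons, List.sum_cons, ih, h,
            List.filter_cons, if_true, if_false, decide_true, decide_false, List.length_cons] <;>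
            push_cast <;> simp [add_comm]
      rw [List.sum_map_mul_left, hcount] at hstep
      simp only [closedPolygon, List.map_append, List.sum_append] at hN ⊢
      rw [segments, hstep]
      push_cast
      linarith
    · rw [add_pos_iff, hmem, List.length_pos_iff_exists_mem]
      simp only [mem_filledAt, Nat.lt_succ_iff_lt_or_eq, List.mem_filter, decide_eq_true_eq]
      constructor
      · rintro (⟨k, hk, h⟩ | ⟨s, hs, h⟩)
        exacts [⟨k, .inl hk, h⟩, ⟨n, .inr rfl, s, hs, h⟩]
      · rintro ⟨k, hk | rfl, h⟩
        exacts [.inl ⟨k, hk, h⟩, .inr h]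

theorem Generic.notMem_segment {p : ℂ} (hp : Generic p) {n : ℕ} {s : ℂ × ℂ}
    (hs : s ∈ segments n) : p ∉ segment ℝ s.1 s.2 := by
  rintro ⟨a, b, ha, hb, hab, rfl⟩
  have e : a • s.1 + b • s.2 = sim s b := by
    have : (a : ℂ) + b = 1 := by exact_mod_cast hab
    simp only [Complex.real_smul, sim]; linear_combination s.1 * this
  have := hp n s hs
  rw [e, simInv_sim (ne_of_mem_segments hs), ht_ofReal] at this
  exact this rfl

theorem Generic.notMem_trace {p : ℂ} (hp : Generic p) (n : ℕ) : p ∉ trace (closedPolygon n) := by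
  simp only [trace, closedPolygon, Set.mem_iUnion, List.mem_append, List.mem_singleton]
  rintro ⟨s, hs | rfl, h⟩
  · exact hp.notMem_segment hs h
  · have h0 : ((0, 1) : ℂ × ℂ) ∈ segments 0 := by simp [segments]
    exact hp.notMem_segment h0 (by rwa [segment_symm] at h)

theorem enclosedRegion_ae_eq (n : ℕ) : enclosedRegion n =ᵐ[volume] filledAt n := by
  filter_upwards [ae_generic] with p hp
  obtain ⟨N, hN, hmem⟩ := hp.exists_winding n
  apply propext
  have hw : windingNumber (closedPolygon n) p = -N := by
    have : ((closedPolygon n).map (angleFrom p)).sum / (2 * Real.pi) = -N := by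
      rw [hN]; field_simp
    exact this
  change p ∉ trace (closedPolygon n) ∧ windingNumber (closedPolygon n) p ≠ 0 ↔ p ∈ filledAt n
  rw [hw, ← hmem, and_iff_right (hp.notMem_trace n), neg_ne_zero, Nat.cast_ne_zero,
    Nat.pos_iff_ne_zero]

theorem one_div_four_mul_sqrt3 : 1 / (4 * √3) = √3 / 12 := by
  have := sqrt3_mul_self
  field_simp
  linarith

theorem areaBetween_eq (n : ℕ) : areaBetween n = 1 / (4 * √3) * (1 - (2 / 3) ^ n) := by
  rw [areaBetween, measureReal_congr (enclosedRegion_ae_eq n), volume_real_filledAt,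
    one_div_four_mul_sqrt3]

end Kochawave

/-! ### Assembly of the main theorem -/

theorem mainTheorem2 :
    (∀ n : ℕ, 3 * Kochawave.areaBetween n + Kochawave.triangleArea n = √3 / 4) ∧
    (∀ n : ℕ, Kochawave.areaBetween n = 1 / (4 * √3) * (1 - (2 / 3 : ℝ) ^ n)) ∧
    Tendsto Kochawave.areaBetween atTop (𝓝 (1 / (4 * √3))) ∧
    volume.real Kochawave.waveRegion = 1 / (4 * √3) ∧
    volume.real Kochawave.waveRegion = volume.real Kochawave.unitTriangle / 3 ∧
    Kochawave.unitTriangle =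
      Kochawave.waveRegionOn 0 1 ∪ Kochawave.waveRegionOn 1 Kochawave.omega ∪
        Kochawave.waveRegionOn Kochawave.omega 0 ∧
    volume (Kochawave.waveRegionOn 0 1 ∩ Kochawave.waveRegionOn 1 Kochawave.omega) = 0 ∧
    volume (Kochawave.waveRegionOn 1 Kochawave.omega ∩
      Kochawave.waveRegionOn Kochawave.omega 0) = 0 ∧
    volume (Kochawave.waveRegionOn Kochawave.omega 0 ∩ Kochawave.waveRegionOn 0 1) = 0 := by
  have h0 : Kochawave.waveRegionOn 0 1 = Kochawave.filled := by
    rw [Kochawave.waveRegionOn_eq, show Kochawave.sim (0, 1) = id from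
      funext Kochawave.sim_unit, Set.image_id]
  rw [h0, Kochawave.waveRegionOn_eq, Kochawave.waveRegionOn_eq, Kochawave.waveRegion_eq_filled,
    Kochawave.volume_real_filled, Kochawave.volume_real_unitTriangle]
  refine ⟨fun n => ?_, Kochawave.areaBetween_eq, ?_, ?_, by ring, Kochawave.unitTriangle_eq_union,
    Kochawave.volume_filled_inter₂, Kochawave.volume_sim_inter, ?_⟩
  · rw [Kochawave.areaBetween_eq, Kochawave.triangleArea_eq, Kochawave.one_div_four_mul_sqrt3]
    ring
  · have h : Tendsto (fun n : ℕ => 1 / (4 * √3) * (1 - (2 / 3 : ℝ) ^ n)) atTop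
        (𝓝 (1 / (4 * √3) * (1 - 0))) :=
      ((tendsto_pow_atTop_nhds_zero_of_lt_one (by norm_num) (by norm_num)).const_sub 1).const_mul _
    rw [sub_zero, mul_one] at h
    exact h.congr fun n => (Kochawave.areaBetween_eq n).symm
  · rw [Kochawave.one_div_four_mul_sqrt3]
  · rw [Set.inter_comm]; exact Kochawave.volume_filled_inter₃
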